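/- Let $K$ be an algebraically closed field of characteristic $0$ and $V$ a $K$-vector space of dimension $n+1$. For $k\le n+1$ let $\nu_k(G_{k,n+1})\subset\mathbb P(\wedge^kV)=\mathbb P^{N_k}$, $N_k=\binom{n+1}{k}-1$, be the Grassmannian of $k$-dimensional subspaces of $V$ in its Plücker embedding (a variety of dimension $k(n+1-k)$), i.e. the set of points $[v_1\wedge\dots\wedge v_k]$ with $v_1,\dots,v_k\in V$ linearly independent. For $s\ge 1$ let $[\nu_k(G_{k,n+1})]^s$ be its $s$-th secant variety, i.e. the Zariski closure of the union of all linear spaces spanned by $s$ points of it. Its expected dimension is $\min\{N_k,\ s\,k(n+1-k)+s-1\}$; it is called defective if its dimension is strictly smaller, and the difference is its defectiveness. The $\wedge$-rank of $T\in\wedge^kV$ is the least $r$ such that $T$ is a sum of $r$ vectors of the form $v_1\wedge\dots\wedge v_k$, and $E(k,n+1)$ is the least $r$ such that some Zariski dense subset of $\wedge^kV$ consists of vectors of $\wedge$-rank at most $r$. Theorem. (i) $E(2,n+1)=\lfloor\frac{n+1}{2}\rfloor$. For every $1\le s<E(2,n+1)$ the dimension of $[\nu_2(G_{2,n+1})]^s$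 falls short of the parameter count $s\cdot 2(n-1)+s-1$ by exactly $2s(s-1)$: $$\dim[\nu_2(G_{2,n+1})]^s=\bigl(s\cdot 2(n-1)+s-1\bigr)-2s(s-1).$$ Its defectiveness is therefore $\min\bigl\{2s(s-1),\binom{n+1-2s}{2}\bigr\}$, which is $2s(s-1)$ whenever $s\cdot 2(n-1)+s-1\le N_2$. In particular, $[\nu_2(G_{2,n+1})]^s$ is defective for every $2\le s<E(2,n+1)$. (ii) If $k\ge 3$, $s\ge 1$ and $ks\le n+1$, then $[\nu_k(G_{k,n+1})]^s$ has the expected dimension: $$\dim[\nu_k(G_{k,n+1})]^s=\min\Bigl\{\binom{n+1}{k}-1,\ s\,k(n+1-k)+s-1\Bigr\}.$$ -/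

import Mathlib

open scoped LinearAlgebra.Projectivization

/-! ### Zariski topologies -/

/-- The topology on `X` whose closed sets are the common zero loci `{x | ∀ f ∈ S, f x = 0}` of sets
`S` of functions taken from a multiplicatively closed family `M` of functions `X → K`. -/
@[reducible]
def zeroLocusTopology {K X : Type*} [Field K] (M : Submonoid (X → K)) : TopologicalSpace X :=
  TopologicalSpace.ofClosed {Z | ∃ S : Set (X → K), S ⊆ M ∧ Z = {x | ∀ f ∈ S, f x = 0}}
    ⟨{1}, by simp [M.one_mem], by ext; simp⟩
    (by
      intro A hA
      refine ⟨{f | f ∈ M ∧ ∀ x ∈ ⋂₀ A, f x = 0}, fun f hf => hf.1, ?_⟩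
      ext x
      refine ⟨fun hx f hf => hf.2 x hx, fun hx Z hZ => ?_⟩
      obtain ⟨S, hS, rfl⟩ := hA hZ
      exact fun f hf => hx f ⟨hS hf, fun y hy => hy _ hZ f hf⟩)
    (by
      rintro _ ⟨S, hS, rfl⟩ _ ⟨T, hT, rfl⟩
      refine ⟨{h | ∃ f ∈ S, ∃ g ∈ T, h = f * g}, ?_, ?_⟩
      · rintro _ ⟨f, hf, g, hg, rfl⟩
        exact M.mul_mem (hS hf) (hT hg)
      · ext x
        constructor
        · rintro (hx | hx) _ ⟨f, hf, g, hg, rfl⟩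
          · simp [hx f hf]
          · simp [hx g hg]
        · intro hx
          by_contra hcon
          simp only [Set.mem_union, Set.mem_ofPred_eq, not_or, not_forall] at hcon
          obtain ⟨⟨f, hf, hfx⟩, ⟨g, hg, hgx⟩⟩ := hcon
          exact mul_ne_zero hfx hgx (hx _ ⟨f, hf, g, hg, rfl⟩))

/-- The value at `w ∈ W` of a polynomial in the linear forms on the vector space `W`. -/
noncomputable def polyEval {K W : Type*} [Field K] [AddCommGroup W] [Module K W]
    (p : MvPolynomial (Module.Dual K W) K) (w : W) : K :=
  MvPolynomial.eval (fun f : Module.Dual K W => f w) p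

/-- The Zariski topology on a `K`-vector space `W`: closed sets are the common zero loci of
polynomial functions. -/
@[reducible]
noncomputable def affineZariski (K W : Type*) [Field K] [AddCommGroup W] [Module K W] :
    TopologicalSpace W :=
  zeroLocusTopology (K := K)
    { carrier := {f | ∃ p : MvPolynomial (Module.Dual K W) K, f = polyEval p}
      one_mem' := ⟨1, by ext; simp [polyEval]⟩
      mul_mem' := by
        rintro _ _ ⟨p, rfl⟩ ⟨q, rfl⟩
        exact ⟨p * q, by ext; simp [polyEval]⟩ }

/-- The Zariski topology on the projective space `ℙ K W`: closed sets are the common zero loci of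
homogeneous polynomials (whose vanishing at a point does not depend on the representative). -/
noncomputable instance projectiveZariski (K W : Type*) [Field K] [AddCommGroup W] [Module K W] :
    TopologicalSpace (ℙ K W) :=
  zeroLocusTopology (K := K)
    { carrier := {f | ∃ (p : MvPolynomial (Module.Dual K W) K) (d : ℕ),
        p.IsHomogeneous d ∧ f = fun x => polyEval p x.rep}
      one_mem' := ⟨1, 0, MvPolynomial.isHomogeneous_one _ _, by ext; simp [polyEval]⟩
      mul_mem' := by
        rintro _ _ ⟨p, d, hp, rfl⟩ ⟨q, e, hq, rfl⟩
        exact ⟨p * q, d + e, hp.mul hq, by ext; simp [polyEval]⟩ }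

/-- The dimension of a subset of projective space: the Krull dimension of the Zariski topology
induced on it. -/
noncomputable def projDim {K W : Type*} [Field K] [AddCommGroup W] [Module K W]
    (Z : Set (ℙ K W)) : WithBot ℕ∞ :=
  topologicalKrullDim Z

/-! ### Grassmannians and their secant varieties -/

/-- The Grassmannian of `k`-dimensional subspaces of `V` in its Plücker embedding: the set of points
`[v₁ ∧ ⋯ ∧ v_k]`, for linearly independent `v₁, …, v_k ∈ V` (equivalently `v₁ ∧ ⋯ ∧ v_k ≠ 0`), of
the projective space of the exterior power. -/
def pluckerGrassmannian (K V : Type*) [Field K] [AddCommGroup V] [Module K V] (k : ℕ) :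
    Set (ℙ K (⋀[K]^k V)) :=
  {x | ∃ (v : Fin k → V) (hv : exteriorPower.ιMulti K k v ≠ 0),
    LinearIndependent K v ∧ x = Projectivization.mk K (exteriorPower.ιMulti K k v) hv}

/-- The `s`-th secant variety of `X`: the Zariski closure of the union of all the linear spaces
spanned by `s` points of `X`. -/
def secantVariety {K W : Type*} [Field K] [AddCommGroup W] [Module K W]
    (X : Set (ℙ K W)) (s : ℕ) : Set (ℙ K W) :=
  closure (⋃ P : Fin s → X,
    (Projectivization.Subspace.span (Set.range fun i => (P i : ℙ K W)) : Set (ℙ K W)))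

/-- The expected dimension `min {N, sd + s - 1}` of the `s`-th secant variety (`s ≥ 1`) of a
`d`-dimensional variety in projective `N`-space. -/
def expectedSecantDim (N d s : ℕ) : ℕ :=
  min N (s * d + s - 1)

/-! ### Rank of exterior vectors -/

/-- The `∧`-rank of an exterior `k`-vector: the least `r` such that it is a sum of `r` decomposable
exterior vectors. -/
noncomputable def wedgeRank {K V : Type*} [Field K] [AddCommGroup V] [Module K V] {k : ℕ}
    (T : ⋀[K]^k V) : ℕ∞ :=
  ⨅ (r : ℕ) (_ : ∃ v : Fin r → Fin k → V, T = ∑ i, exteriorPower.ιMulti K k (v i)), (r : ℕ∞)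

/-- The typical rank `E(k, dim V)`: the least `r` such that all the vectors of some Zariski dense
subset of the `k`-th exterior power of `V` have `∧`-rank at most `r`. -/
noncomputable def typicalRank (K V : Type*) [Field K] [AddCommGroup V] [Module K V] (k : ℕ) : ℕ∞ :=
  sInf {r | ∃ U : Set (⋀[K]^k V),
    @Dense _ (affineZariski K (⋀[K]^k V)) U ∧ ∀ T ∈ U, wedgeRank T ≤ r}

/-! Everything reduces to one dimension count, `projDim_closure_eq`. If the cone over a set is
parametrized, up to Zariski closure, by a polynomial map `φ` in `D + 1` variables that is an
immersion at some point, then the closure has Krull dimension `D`. For the upper bound, each strict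
inclusion in a chain of irreducible closed sets adds one polynomial to a family independent on the
cone (`IndepOn.cons`); pulled back along `φ`, the family is algebraically independent in a
polynomial ring of transcendence degree `D + 1`. For the lower bound, restricting `φ` to more and
more coordinates gives a chain of irreducible closed sets. It is strict because the Jacobian
criterion in characteristic zero produces more independent linear forms than the previous stage has
parameters.

The base point is a sum of `s` wedges of disjoint blocks of basis vectors, where all partial
derivatives are wedges of basis vectors, so immersivity is a matter of distinct index sets (a
concrete form of Terracini's lemma). For `k ≥ 3` a tangent direction at one block retains at least
two indices of that block, so the `s` tangent spaces are independent and the parameter count is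
exact.

For `k = 2` the tangent spaces overlap: `e_a ∧ e_b`, with `a` and `b` in different blocks, is
tangent at both. The redundancy is removed by using `2s` vectors in a chart and one coefficient per
pair of them. The normal form of bivectors (`isWedgeSum_of_mem_wedgeSquare`) shows that every value
is still a sum of `s` decomposables. The parameter count is `C(n+1,2) - C(n+1-2s,2)`, which gives
both the defect and, since it is less than `dim ⋀²V` when `n+1-2s ≥ 2`, the lower bound for the
typical rank; the normal form gives the upper bound. -/

/-! ### Polynomial maps -/

section PolyMap

variable {K W : Type*} [Field K] [AddCommGroup W] [Module K W]

/-- A map from an affine space to a vector space is polynomial if its composition with every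
linear form is given by a polynomial. -/
def IsPolyMap {ι : Type*} (φ : (ι → K) → W) : Prop :=
  ∀ ℓ : Module.Dual K W, ∃ p : MvPolynomial ι K, ∀ x, MvPolynomial.eval x p = ℓ (φ x)

namespace IsPolyMap

variable {ι κ : Type*}

/-- Linear forms are the indeterminates of the source ring, so choosing a polynomial for each `ℓ ∘
φ` determines an algebra map. -/
theorem exists_pullback {φ : (ι → K) → W} (hφ : IsPolyMap φ) :
    ∃ Φ : MvPolynomial (Module.Dual K W) K →ₐ[K] MvPolynomial ι K,
      ∀ p x, MvPolynomial.eval x (Φ p) = polyEval p (φ x) := by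
  choose f hf using hφ
  refine ⟨MvPolynomial.aeval f, fun p x => ?_⟩
  rw [MvPolynomial.aeval_def, ← MvPolynomial.coe_eval₂Hom, ← RingHom.comp_apply]
  unfold polyEval
  congr 1
  ext <;> simp [hf]

theorem const (w : W) : IsPolyMap (fun _ : ι → K => w) := fun ℓ =>
  ⟨MvPolynomial.C (ℓ w), fun x => by simp⟩

theorem add {φ ψ : (ι → K) → W} (hφ : IsPolyMap φ) (hψ : IsPolyMap ψ) :
    IsPolyMap (fun x => φ x + ψ x) := fun ℓ => by
  obtain ⟨p, hp⟩ := hφ ℓ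
  obtain ⟨q, hq⟩ := hψ ℓ
  exact ⟨p + q, fun x => by simp [hp, hq]⟩

theorem smul {f : (ι → K) → K} {φ : (ι → K) → W} (hf : IsPolyMap f) (hφ : IsPolyMap φ) :
    IsPolyMap (fun x => f x • φ x) := fun ℓ => by
  obtain ⟨p, hp⟩ := hφ ℓ
  obtain ⟨q, hq⟩ := hf LinearMap.id
  exact ⟨q * p, fun x => by simp [hp, hq]⟩

theorem coord (i : ι) : IsPolyMap (fun x : ι → K => x i) := fun ℓ =>
  ⟨MvPolynomial.C (ℓ 1) * MvPolynomial.X i, fun x => by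
    simp only [map_mul, MvPolynomial.eval_C, MvPolynomial.eval_X]
    rw [mul_comm, ← smul_eq_mul, ← map_smul, smul_eq_mul, mul_one]⟩

theorem sum {α : Type*} (s : Finset α) {φ : α → (ι → K) → W} (hφ : ∀ a ∈ s, IsPolyMap (φ a)) :
    IsPolyMap (fun x => ∑ a ∈ s, φ a x) := by
  classical
  induction s using Finset.induction_on with
  | empty => simpa using const 0
  | insert a s ha ih =>
    simp only [Finset.sum_insert ha]
    exact (hφ a (by simp)).add (ih fun b hb => hφ b (by simp [hb]))

theorem prod {α : Type*} (s : Finset α) {f : α → (ι → K) → K} (hf : ∀ a ∈ s, IsPolyMap (f a)) :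
    IsPolyMap (fun x => ∏ a ∈ s, f a x) := by
  classical
  induction s using Finset.induction_on with
  | empty => simpa using const 1
  | insert a s ha ih =>
    simp only [Finset.prod_insert ha]
    exact (hf a (by simp)).smul (ih fun b hb => hf b (by simp [hb]))

theorem comp {φ : (ι → K) → W} {g : (κ → K) → (ι → K)} (hφ : IsPolyMap φ)
    (hg : ∀ i, IsPolyMap (fun x => g x i)) : IsPolyMap (fun x => φ (g x)) := fun ℓ => by
  obtain ⟨p, hp⟩ := hφ ℓ
  choose q hq using fun i => hg i LinearMap.id
  refine ⟨MvPolynomial.bind₁ q p, fun x => ?_⟩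
  rw [← hp, ← MvPolynomial.coe_aeval_eq_eval, ← MvPolynomial.coe_aeval_eq_eval]
  simp only [RingHom.coe_coe, MvPolynomial.aeval_bind₁]
  congr 2
  ext i
  simpa using hq i x

theorem multilinear {k : ℕ} {V : Type*} [AddCommGroup V] [Module K V] [FiniteDimensional K V]
    (f : MultilinearMap K (fun _ : Fin k => V) W) {v : Fin k → (ι → K) → V}
    (hv : ∀ i, IsPolyMap (v i)) : IsPolyMap (fun x => f (fun i => v i x)) := by
  let b := Module.finBasis K V
  have : (fun x => f (fun i => v i x)) = fun x =>
      ∑ r : Fin k → Fin (Module.finrank K V), (∏ i, b.repr (v i x) (r i)) • f (fun i => b (r i)) := by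
    ext x
    conv_lhs => rw [show (fun i => v i x) = fun i => ∑ j, b.repr (v i x) j • b j from
      funext fun i => (b.sum_repr (v i x)).symm]
    rw [MultilinearMap.map_sum]
    refine Finset.sum_congr rfl fun r _ => ?_
    rw [MultilinearMap.map_smul_univ]
  rw [this]
  refine sum _ fun r _ => smul (prod _ fun i _ => fun ℓ => ?_) (const _)
  obtain ⟨p, hp⟩ := hv i (ℓ ∘ₗ b.coord (r i))
  exact ⟨p, fun x => by simp [hp]⟩

/-- If a polynomial vanishes at almost all points of a parametrized line, it vanishes on the whole
line. -/
theorem polyEval_eq_zero_of_finite [Infinite K] {φ : (Unit → K) → W} (hφ : IsPolyMap φ)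
    (p : MvPolynomial (Module.Dual K W) K) {s : Set K} (hs : s.Finite)
    (h : ∀ t ∉ s, polyEval p (φ fun _ => t) = 0) (t : K) : polyEval p (φ fun _ => t) = 0 := by
  obtain ⟨Φ, hΦ⟩ := hφ.exists_pullback
  let f : MvPolynomial Unit K →ₐ[K] Polynomial K := MvPolynomial.aeval fun _ => Polynomial.X
  have hf : ∀ (q : MvPolynomial Unit K) t, (f q).eval t = MvPolynomial.eval (fun _ => t) q := by
    intro q t
    rw [← Polynomial.coe_evalRingHom, ← AlgHom.coe_toRingHom, ← RingHom.comp_apply]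
    congr 1
    ext <;> simp [f]
  have key : f (Φ p) = 0 :=
    Polynomial.eq_zero_of_infinite_isRoot _ <| hs.infinite_compl.mono fun t ht => by
      simpa [hf, hΦ] using h t ht
  rw [← hΦ, ← hf, key, Polynomial.eval_zero]

end IsPolyMap

end PolyMap

/-! ### The Jacobian criterion -/

section Jacobian

variable {K : Type*} [Field K]

theorem MvPolynomial.pderiv_aeval {σ τ : Type*} [Fintype σ] (g : σ → MvPolynomial τ K) (j : τ)
    (F : MvPolynomial σ K) :
    pderiv j (aeval g F) = ∑ i, aeval g (pderiv i F) * pderiv j (g i) := by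
  classical
  induction F using MvPolynomial.induction_on with
  | C a => simp
  | add p q hp hq => simp only [map_add, hp, hq, add_mul, Finset.sum_add_distrib]
  | mul_X p i hp =>
    simp only [map_mul, aeval_X, Derivation.leibniz, smul_eq_mul, pderiv_X, map_add, add_mul,
      Finset.sum_add_distrib, hp, Finset.mul_sum, Pi.single_apply]
    congr 1
    · simp [mul_ite, ite_mul]
    · exact Finset.sum_congr rfl fun _ _ => by ring

/-- If `m i ≠ 0`, the coefficient of `∂ᵢF` at `m - eᵢ` is `m i` times that of `F` at `m`, and `m i`
is invertible in characteristic zero. -/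
theorem MvPolynomial.eq_C_of_pderiv_eq_zero [CharZero K] {σ : Type*} (F : MvPolynomial σ K)
    (h : ∀ i, pderiv i F = 0) : F = C (coeff 0 F) := by
  classical
  ext m
  rw [coeff_C]
  split_ifs with hm
  · rw [hm]
  · obtain ⟨i, hi⟩ : ∃ i, m i ≠ 0 := by
      by_contra hcon
      push Not at hcon
      exact hm (by ext i; simp [hcon i])
    have := congrArg (coeff (m - Finsupp.single i 1)) (h i)
    rw [coeff_pderiv, tsub_add_cancel_of_le (by simpa [Nat.one_le_iff_ne_zero] using hi)] at this
    simpa using (mul_eq_zero.1 this).resolve_right (Nat.cast_add_one_ne_zero _)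

theorem MvPolynomial.totalDegree_pderiv_lt {σ : Type*} (F : MvPolynomial σ K) (i : σ)
    (h : pderiv i F ≠ 0) : (pderiv i F).totalDegree < F.totalDegree := by
  classical
  have hs : (pderiv i F).support.Nonempty := support_nonempty.2 h
  rw [totalDegree, Finset.sup_lt_iff]
  · intro m hm
    rw [mem_support_iff, coeff_pderiv] at hm
    have := le_totalDegree (mem_support_iff.2 (left_ne_zero_of_mul hm))
    rw [Finsupp.sum_add_index' (by simp) (by simp), Finsupp.sum_single_index rfl] at this
    omega
  · obtain ⟨m, hm⟩ := hs
    rw [mem_support_iff, coeff_pderiv] at hm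
    have := le_totalDegree (mem_support_iff.2 (left_ne_zero_of_mul hm))
    rw [Finsupp.sum_add_index' (by simp) (by simp), Finsupp.sum_single_index rfl] at this
    simp only [bot_eq_zero']
    omega

/-- Differentiating a relation `F(g) = 0` shows that the row `(∂ᵢF)(g)` is killed by the Jacobian
matrix, whose determinant is nonzero because it is `1` at `x`. So each `∂ᵢF` is a relation of
smaller degree, hence zero by induction, and `F` is constant. -/
theorem algebraicIndependent_of_jacobian [CharZero K] {σ : Type*} [Fintype σ] [DecidableEq σ]
    (g : σ → MvPolynomial σ K) (x : σ → K)
    (h : ∀ i j, MvPolynomial.eval x (MvPolynomial.pderiv j (g i)) = if i = j then 1 else 0) :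
    AlgebraicIndependent K g := by
  have hdet : (Matrix.of fun i j => MvPolynomial.pderiv j (g i)).det ≠ 0 := by
    intro h0
    have := congrArg (MvPolynomial.eval x) h0
    rw [RingHom.map_det] at this
    have hone : (MvPolynomial.eval x).mapMatrix (Matrix.of fun i j => MvPolynomial.pderiv j (g i))
        = 1 := by
      ext i j
      simp [h, Matrix.one_apply]
    rw [hone] at this
    simp at this
  rw [algebraicIndependent_iff]
  suffices ∀ (n : ℕ) (F : MvPolynomial σ K), F.totalDegree = n → MvPolynomial.aeval g F = 0 → F = 0
    from fun F hF => this _ F rfl hF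
  intro n
  induction n using Nat.strong_induction_on with
  | _ n ih =>
    intro F hn hF
    have hv : Matrix.vecMul (fun i => MvPolynomial.aeval g (MvPolynomial.pderiv i F))
        (Matrix.of fun i j => MvPolynomial.pderiv j (g i)) = 0 := by
      ext1 j
      have := MvPolynomial.pderiv_aeval g j F
      rw [hF, map_zero] at this
      simpa [Matrix.vecMul, dotProduct] using this.symm
    have hz := Matrix.eq_zero_of_vecMul_eq_zero hdet hv
    have hd : ∀ i, MvPolynomial.pderiv i F = 0 := by
      intro i
      by_contra hne
      exact hne (ih _ (hn ▸ F.totalDegree_pderiv_lt i hne) _ rfl (congrFun hz i))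
    rw [F.eq_C_of_pderiv_eq_zero hd] at hF ⊢
    rw [MvPolynomial.aeval_C] at hF
    rw [(FaithfulSMul.algebraMap_eq_zero_iff K _).1 hF, map_zero]

/-- The partial derivative of a polynomial whose restriction to a coordinate line is affine. -/
theorem MvPolynomial.eval_pderiv_of_affine [Infinite K] {σ : Type*} [DecidableEq σ]
    (g : MvPolynomial σ K) (x : σ → K) (j : σ) (a b : K)
    (h : ∀ t, eval (x + Pi.single j t) g = a + t * b) : eval x (pderiv j g) = b := by
  -- Restriction to the line `x + t eⱼ`; it turns `pderiv j` into the ordinary derivative.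
  let f : MvPolynomial σ K →ₐ[K] Polynomial K :=
    aeval fun i => Polynomial.C (x i) + Polynomial.C (Pi.single (M := fun _ => K) j 1 i) * Polynomial.X
  have hf : ∀ (p : MvPolynomial σ K) t, (f p).eval t = eval (x + Pi.single j t) p := by
    intro p t
    rw [← Polynomial.coe_evalRingHom, ← AlgHom.coe_toRingHom, ← RingHom.comp_apply]
    congr 1
    ext i
    · simp [f]
    · by_cases hij : i = j <;> simp [f, hij]
  have hder : ∀ p : MvPolynomial σ K, Polynomial.derivative (f p) = f (pderiv j p) := by
    intro p
    induction p using MvPolynomial.induction_on with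
    | C a => simp [f]
    | add p q hp hq => simp [hp, hq]
    | mul_X p i hp =>
      by_cases hij : i = j
      · subst hij
        simp [hp, Derivation.leibniz, f]
        ring
      · simp [hp, Derivation.leibniz, f, pderiv_X, hij]
        ring
  have hg : f g = Polynomial.C a + Polynomial.X * Polynomial.C b := by
    apply Polynomial.funext
    intro t
    simp only [hf, h, Polynomial.eval_add, Polynomial.eval_C, Polynomial.eval_mul, Polynomial.eval_X]
  have := congrArg (fun q => Polynomial.eval 0 (Polynomial.derivative q)) hg
  simp only [hder, hf] at this
  simpa using this

end Jacobian

/-! ### Cones over projective sets -/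

section Cone

variable {K W : Type*} [Field K] [AddCommGroup W] [Module K W]

/-- A polynomial in the linear forms vanishes on a set of vectors. -/
def VanishesOn (p : MvPolynomial (Module.Dual K W) K) (C : Set W) : Prop :=
  ∀ w ∈ C, polyEval p w = 0

/-- The affine cone over a subset of projective space. -/
def affineCone (Z : Set (ℙ K W)) : Set W :=
  {w | ∃ x ∈ Z, ∃ t : K, w = t • x.rep}

theorem affineCone_mono {Y Z : Set (ℙ K W)} (h : Y ⊆ Z) : affineCone Y ⊆ affineCone Z :=
  fun _ ⟨x, hx, t, ht⟩ => ⟨x, h hx, t, ht⟩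

theorem VanishesOn.mono {p : MvPolynomial (Module.Dual K W) K} {C D : Set W}
    (hp : VanishesOn p D) (h : C ⊆ D) : VanishesOn p C := fun w hw => hp w (h hw)

theorem mem_affineCone_of_mk {Z : Set (ℙ K W)} {w : W} (hw : w ≠ 0)
    (h : Projectivization.mk K w hw ∈ Z) : w ∈ affineCone Z := by
  obtain ⟨a, ha⟩ := Projectivization.exists_smul_eq_mk_rep K w hw
  refine ⟨_, h, ((a⁻¹ : Kˣ) : K), ?_⟩
  rw [← ha, ← Units.smul_def, inv_smul_smul]

theorem polyEval_mul (p q : MvPolynomial (Module.Dual K W) K) (w : W) :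
    polyEval (p * q) w = polyEval p w * polyEval q w := map_mul _ _ _

theorem polyEval_smul_of_isHomogeneous {p : MvPolynomial (Module.Dual K W) K} {d : ℕ}
    (hp : p.IsHomogeneous d) (t : K) (w : W) : polyEval p (t • w) = t ^ d * polyEval p w := by
  unfold polyEval
  rw [MvPolynomial.eval_eq, MvPolynomial.eval_eq, Finset.mul_sum]
  refine Finset.sum_congr rfl fun m hm => ?_
  have hd := hp (MvPolynomial.mem_support_iff.1 hm)
  simp only [map_smul, smul_eq_mul, mul_pow, Finset.prod_mul_distrib, Finset.prod_pow_eq_pow_sum]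
  have : ∑ i ∈ m.support, m i = d := by
    rw [← hd, Finsupp.weight_apply]
    simp [Finsupp.sum]
  rw [this]
  ring

theorem isClosed_projective_iff {Z : Set (ℙ K W)} :
    IsClosed Z ↔ ∃ S : Set (MvPolynomial (Module.Dual K W) K),
      (∀ p ∈ S, ∃ d, p.IsHomogeneous d) ∧ Z = {x | ∀ p ∈ S, polyEval p x.rep = 0} := by
  rw [← isOpen_compl_iff]
  change Zᶜᶜ ∈ {Z : Set (ℙ K W) | ∃ S : Set (ℙ K W → K), S ⊆ _ ∧ Z = {x | ∀ f ∈ S, f x = 0}} ↔ _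
  rw [compl_compl]
  constructor
  · rintro ⟨S, hS, rfl⟩
    refine ⟨{p | (∃ d, p.IsHomogeneous d) ∧ (fun x : ℙ K W => polyEval p x.rep) ∈ S},
      fun p hp => hp.1, ?_⟩
    ext x
    refine ⟨fun hx p hp => hx _ hp.2, fun hx f hf => ?_⟩
    obtain ⟨p, d, hp, rfl⟩ := hS hf
    exact hx p ⟨⟨d, hp⟩, hf⟩
  · rintro ⟨S, hS, rfl⟩
    refine ⟨(fun p (x : ℙ K W) => polyEval p x.rep) '' S, ?_, ?_⟩
    · rintro _ ⟨p, hp, rfl⟩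
      obtain ⟨d, hd⟩ := hS p hp
      exact ⟨p, d, hd, rfl⟩
    · ext x
      simp

/-- A closed set is separated from a point outside by a polynomial vanishing on its cone. -/
theorem exists_vanishesOn_affineCone {Z : Set (ℙ K W)} (hZ : IsClosed Z) {x : ℙ K W} (hx : x ∉ Z) :
    ∃ p : MvPolynomial (Module.Dual K W) K, (∃ d, p.IsHomogeneous d) ∧
      VanishesOn p (affineCone Z) ∧ polyEval p x.rep ≠ 0 := by
  obtain ⟨S, hS, rfl⟩ := isClosed_projective_iff.1 hZ
  simp only [Set.mem_ofPred_eq, not_forall] at hx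
  obtain ⟨p, hp, hpx⟩ := hx
  obtain ⟨d, hd⟩ := hS p hp
  refine ⟨p, ⟨d, hd⟩, ?_, hpx⟩
  rintro _ ⟨y, hy, t, rfl⟩
  rw [polyEval_smul_of_isHomogeneous hd, hy p hp, mul_zero]

/-- The points whose whole line lies in the zero locus of a polynomial form a closed set. -/
theorem isClosed_setOf_line [Infinite K] (p : MvPolynomial (Module.Dual K W) K) :
    IsClosed {x : ℙ K W | ∀ t : K, polyEval p (t • x.rep) = 0} := by
  rw [isClosed_projective_iff]
  refine ⟨Set.range fun d => MvPolynomial.homogeneousComponent d p, ?_, ?_⟩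
  · rintro _ ⟨d, rfl⟩
    exact ⟨d, MvPolynomial.homogeneousComponent_isHomogeneous d p⟩
  ext x
  -- Along the line through `x`, `p` is a polynomial in `t` whose coefficients are the values of its
  -- homogeneous components at `x.rep`.
  have key : ∀ t : K, polyEval p (t • x.rep) =
      (∑ d ∈ Finset.range (p.totalDegree + 1), Polynomial.C
        (polyEval (MvPolynomial.homogeneousComponent d p) x.rep) * Polynomial.X ^ d).eval t := by
    intro t
    conv_lhs => rw [← MvPolynomial.sum_homogeneousComponent p]
    rw [polyEval, map_sum, Polynomial.eval_finsetSum]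
    refine Finset.sum_congr rfl fun d _ => ?_
    have := polyEval_smul_of_isHomogeneous
      (MvPolynomial.homogeneousComponent_isHomogeneous d p) t x.rep
    rw [polyEval] at this
    rw [this, Polynomial.eval_mul, Polynomial.eval_C, Polynomial.eval_pow, Polynomial.eval_X,
      mul_comm]
  simp only [Set.mem_ofPred_eq, Set.forall_mem_range]
  constructor
  · intro h d
    have hz : (∑ d ∈ Finset.range (p.totalDegree + 1), Polynomial.C
        (polyEval (MvPolynomial.homogeneousComponent d p) x.rep) * Polynomial.X ^ d) = 0 :=
      Polynomial.funext fun t => by rw [← key, h, Polynomial.eval_zero]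
    by_cases hd : d < p.totalDegree + 1
    · have := congrArg (Polynomial.coeff · d) hz
      simpa [Polynomial.finsetSum_coeff, Polynomial.coeff_X_pow, hd] using this
    · rw [MvPolynomial.homogeneousComponent_eq_zero _ _ (by omega)]
      simp [polyEval]
  · intro h t
    rw [key]
    simp [h]

/-- Here `p` may be inhomogeneous: the points whose whole line lies in its zero locus still form a
closed set. -/
theorem VanishesOn.affineCone_closure [Infinite K] {p : MvPolynomial (Module.Dual K W) K}
    {S : Set (ℙ K W)} (hp : VanishesOn p (affineCone S)) :
    VanishesOn p (affineCone (closure S)) := by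
  have : closure S ⊆ {x : ℙ K W | ∀ t : K, polyEval p (t • x.rep) = 0} :=
    closure_minimal (fun x hx t => hp _ ⟨x, hx, t, rfl⟩) (isClosed_setOf_line p)
  rintro _ ⟨x, hx, t, rfl⟩
  exact this hx t

/-- The vanishing ideal of the cone over an irreducible set is prime. -/
theorem IsIrreducible.vanishesOn_or [Infinite K] {Z : Set (ℙ K W)} (hZ : IsIrreducible Z)
    {p q : MvPolynomial (Module.Dual K W) K} (h : VanishesOn (p * q) (affineCone Z)) :
    VanishesOn p (affineCone Z) ∨ VanishesOn q (affineCone Z) := by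
  -- On each line the product vanishes in the domain `K[t]`, so one factor vanishes on the whole
  -- line; irreducibility then makes the choice uniform.
  have hcov : Z ⊆ {x : ℙ K W | ∀ t : K, polyEval p (t • x.rep) = 0} ∪
      {x : ℙ K W | ∀ t : K, polyEval q (t • x.rep) = 0} := by
    intro x hx
    have hline : ∀ r : MvPolynomial (Module.Dual K W) K, ∃ f : Polynomial K,
        ∀ t, f.eval t = polyEval r (t • x.rep) := by
      intro r
      refine ⟨MvPolynomial.aeval (fun ℓ : Module.Dual K W => Polynomial.C (ℓ x.rep) * .X) r,
        fun t => ?_⟩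
      rw [← Polynomial.coe_evalRingHom, ← AlgHom.coe_toRingHom, ← RingHom.comp_apply, polyEval]
      congr 1
      ext ℓ
      · simp
      · simpa using mul_comm (ℓ x.rep) t
    obtain ⟨f, hf⟩ := hline p
    obtain ⟨g, hg⟩ := hline q
    have : f * g = 0 := Polynomial.funext fun t => by
      rw [Polynomial.eval_mul, hf, hg, ← polyEval_mul, h _ ⟨x, hx, t, rfl⟩, Polynomial.eval_zero]
    rcases mul_eq_zero.1 this with h0 | h0
    · exact Or.inl fun t => by rw [← hf, h0, Polynomial.eval_zero]
    · exact Or.inr fun t => by rw [← hg, h0, Polynomial.eval_zero]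
  rcases isPreirreducible_iff_isClosed_union_isClosed.1 hZ.2 _ _ (isClosed_setOf_line p)
    (isClosed_setOf_line q) hcov with h' | h'
  · left
    rintro _ ⟨x, hx, t, rfl⟩
    exact h' hx t
  · right
    rintro _ ⟨x, hx, t, rfl⟩
    exact h' hx t

/-! ### Algebraic independence on a set of vectors -/

/-- A family of polynomials is independent on `C` if no nontrivial polynomial relation between them
holds on `C`. -/
def IndepOn {τ : Type*} (C : Set W) (F : τ → MvPolynomial (Module.Dual K W) K) : Prop :=
  ∀ Q : MvPolynomial τ K, VanishesOn (MvPolynomial.aeval F Q) C → Q = 0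

theorem polyEval_aeval {τ : Type*} (F : τ → MvPolynomial (Module.Dual K W) K)
    (Q : MvPolynomial τ K) (w : W) :
    polyEval (MvPolynomial.aeval F Q) w = MvPolynomial.eval (fun i => polyEval (F i) w) Q := by
  rw [polyEval, ← AlgHom.coe_toRingHom, ← RingHom.comp_apply]
  congr 1
  ext <;> simp [polyEval]

theorem IndepOn.mono {τ : Type*} {C D : Set W} {F : τ → MvPolynomial (Module.Dual K W) K}
    (hF : IndepOn C F) (h : ∀ p : MvPolynomial (Module.Dual K W) K, VanishesOn p D → VanishesOn p C) :
    IndepOn D F :=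
  fun Q hQ => hF Q (h _ hQ)

/-- A family can be enlarged by a polynomial vanishing on a smaller set where the family is already
independent. -/
theorem IndepOn.cons {r : ℕ} {C D : Set W} {F : Fin r → MvPolynomial (Module.Dual K W) K}
    (hF : IndepOn C F) (hCD : C ⊆ D)
    (hD : ∀ p q : MvPolynomial (Module.Dual K W) K, VanishesOn (p * q) D →
      VanishesOn p D ∨ VanishesOn q D)
    {f : MvPolynomial (Module.Dual K W) K} (hfC : VanishesOn f C) (hfD : ¬ VanishesOn f D) :
    IndepOn D (Fin.cons f F : Fin (r + 1) → MvPolynomial (Module.Dual K W) K) := by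
  intro Q hQ
  by_contra hne
  -- Write `Q = X₀ᵐ Q'` with `X₀ ∤ Q'`. Primeness cancels `fᵐ`, so `Q'` is a relation on `D`. On
  -- `C`, where `f = 0`, it becomes a relation among `F`, forcing `Q'(0, ·) = 0`, that is `X₀ ∣ Q'`.
  obtain ⟨P, hP, hdvd⟩ := Polynomial.exists_eq_pow_rootMultiplicity_mul_and_not_dvd
    (MvPolynomial.finSuccEquiv K r Q) (by simpa using hne) 0
  set m := Polynomial.rootMultiplicity 0 (MvPolynomial.finSuccEquiv K r Q)
  rw [Polynomial.C_0, sub_zero] at hP hdvd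
  obtain ⟨Q', rfl⟩ := (MvPolynomial.finSuccEquiv K r).surjective P
  have hQ' : Q = MvPolynomial.X 0 ^ m * Q' := by
    apply (MvPolynomial.finSuccEquiv K r).injective
    rw [hP, map_mul, map_pow, MvPolynomial.finSuccEquiv_X_zero]
  have hpow : ∀ j : ℕ, ∀ p : MvPolynomial (Module.Dual K W) K, VanishesOn (f ^ j * p) D → VanishesOn p D := by
    intro j
    induction j with
    | zero => simp
    | succ j ih =>
      intro p hp
      rw [pow_succ', mul_assoc] at hp
      exact ih p ((hD _ _ hp).resolve_left hfD)
  have hv : VanishesOn (MvPolynomial.aeval (Fin.cons f F) Q') D := by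
    apply hpow m
    rw [hQ'] at hQ
    simpa using hQ
  apply hdvd
  rw [Polynomial.X_dvd_iff]
  apply hF
  intro w hw
  have := hv w (hCD hw)
  rw [polyEval_aeval] at this ⊢
  have hcons : (fun i => polyEval ((Fin.cons f F : Fin (r + 1) → _) i) w) =
      Fin.cons 0 fun i => polyEval (F i) w := by
    ext i
    refine Fin.cases ?_ (fun i => ?_) i
    · simpa using hfC w hw
    · simp
  rw [hcons, MvPolynomial.eval_eq_eval_mv_eval'] at this
  rwa [← Polynomial.coeff_zero_eq_eval_zero, Polynomial.coeff_map] at this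

/-- The size of an independent family is bounded by the number of parameters. -/
theorem IndepOn.le_card {ι : Type*} [Fintype ι] {φ : (ι → K) → W} (hφ : IsPolyMap φ) {r : ℕ}
    {C : Set W} {F : Fin r → MvPolynomial (Module.Dual K W) K} (hF : IndepOn C F)
    (h : ∀ p : MvPolynomial (Module.Dual K W) K, VanishesOn p (Set.range φ) → VanishesOn p C) :
    r ≤ Fintype.card ι := by
  obtain ⟨Φ, hΦ⟩ := hφ.exists_pullback
  have hind : AlgebraicIndependent K (Φ ∘ F) := by
    rw [algebraicIndependent_iff]
    intro Q hQ
    refine hF Q (h _ ?_)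
    rintro _ ⟨x, rfl⟩
    rw [← hΦ, ← AlgHom.comp_apply, MvPolynomial.comp_aeval]
    simp only [Function.comp_def] at hQ
    rw [hQ, map_zero]
  have := hind.lift_cardinalMk_le_trdeg
  rw [MvPolynomial.trdeg_of_isDomain] at this
  simpa using this

/-- The Jacobian criterion for linear coordinates of a polynomial map. -/
theorem IsPolyMap.indepOn_range [CharZero K] {ι : Type*} [Fintype ι] [DecidableEq ι]
    {φ : (ι → K) → W} (hφ : IsPolyMap φ) (y : ι → K) (w : ι → W)
    (hw : ∀ j t, φ (y + Pi.single j t) = φ y + t • w j) (ℓ : ι → Module.Dual K W)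
    (hℓ : ∀ i j, ℓ i (w j) = if i = j then 1 else 0) :
    IndepOn (Set.range φ) fun i => (MvPolynomial.X (ℓ i) : MvPolynomial (Module.Dual K W) K) := by
  obtain ⟨Φ, hΦ⟩ := hφ.exists_pullback
  have hind : AlgebraicIndependent K fun i => Φ (MvPolynomial.X (ℓ i)) := by
    refine algebraicIndependent_of_jacobian _ y fun i j => ?_
    rw [← hℓ]
    -- Since `φ` is affine on each coordinate line through `y`, its partial derivatives there are
    -- the `w j`.
    refine MvPolynomial.eval_pderiv_of_affine _ y j (ℓ i (φ y)) _ fun t => ?_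
    rw [hΦ, hw]
    simp [polyEval]
  intro Q hQ
  rw [algebraicIndependent_iff] at hind
  apply hind
  apply MvPolynomial.funext
  intro x
  have := hQ _ ⟨x, rfl⟩
  rw [← hΦ, ← AlgHom.comp_apply, MvPolynomial.comp_aeval] at this
  rw [this, map_zero]

end Cone

/-! ### Dimension bounds -/

section Dimension

variable {K W : Type*} [Field K] [AddCommGroup W] [Module K W]

/-- The bottom of a chain already contributes one form: the cone contains a line on which `ℓ` takes
every value. -/
theorem exists_indepOn_affineCone_of_nonempty [Infinite K] {Z : Set (ℙ K W)} (hZ : Z.Nonempty) :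
    ∃ F : Fin 1 → MvPolynomial (Module.Dual K W) K, IndepOn (affineCone Z) F := by
  obtain ⟨x, hx⟩ := hZ
  obtain ⟨ℓ, hℓ⟩ := Module.Projective.exists_dual_eq_one K x.rep_nonzero
  refine ⟨fun _ => MvPolynomial.X ℓ, fun Q hQ => MvPolynomial.funext fun t => ?_⟩
  have := hQ _ ⟨x, hx, t 0, rfl⟩
  rw [polyEval_aeval] at this
  rw [map_zero, ← this]
  congr 2
  ext i
  simp [polyEval, hℓ, Subsingleton.elim i 0]

/-- If at most `D + 1` polynomials are independent on the cone over `Z`, then the dimension of `Z`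
is at most `D`. -/
theorem projDim_le_of_indepOn_le [Infinite K] {Z : Set (ℙ K W)} {D : ℕ}
    (h : ∀ (r : ℕ) (F : Fin r → MvPolynomial (Module.Dual K W) K),
      IndepOn (affineCone Z) F → r ≤ D + 1) : projDim Z ≤ D := by
  let cn : TopologicalSpace.IrreducibleCloseds Z → Set W := fun C =>
    affineCone (Subtype.val '' (C : Set Z))
  have hstep : ∀ (B C : TopologicalSpace.IrreducibleCloseds Z), B < C → ∀ (r : ℕ)
      (F : Fin r → MvPolynomial (Module.Dual K W) K), IndepOn (cn B) F →
      ∃ G : Fin (r + 1) → MvPolynomial (Module.Dual K W) K, IndepOn (cn C) G := by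
    intro B C hBC r F hF
    have hsub : (B : Set Z) ⊂ C := hBC
    obtain ⟨x, hxC, hxB⟩ := Set.exists_of_ssubset hsub
    obtain ⟨T, hT, hTB⟩ := isClosed_induced_iff.1 B.isClosed
    have hxT : (x : ℙ K W) ∉ T := fun hx => hxB (by rw [← hTB]; exact hx)
    obtain ⟨f, -, hfT, hfx⟩ := exists_vanishesOn_affineCone hT hxT
    refine ⟨Fin.cons f F, hF.cons (affineCone_mono (Set.image_mono hsub.subset)) ?_
      (hfT.mono (affineCone_mono ?_)) fun hf => hfx ?_⟩
    · exact fun p q => IsIrreducible.vanishesOn_or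
        (C.isIrreducible.image _ continuous_subtype_val.continuousOn)
    · rintro _ ⟨y, hy, rfl⟩
      rw [← hTB] at hy
      exact hy
    · simpa using hf _ ⟨x, ⟨x, hxC, rfl⟩, 1, rfl⟩
  rw [projDim, topologicalKrullDim, Order.krullDim]
  refine iSup_le fun p => ?_
  -- The `i`-th member of the chain carries `i + 1` independent polynomials: one for nonemptiness
  -- and one per strict inclusion.
  suffices ∀ i : ℕ, ∀ hi : i < p.length + 1,
      ∃ F : Fin (i + 1) → MvPolynomial (Module.Dual K W) K, IndepOn (cn (p ⟨i, hi⟩)) F by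
    obtain ⟨F, hF⟩ := this p.length (Nat.lt_succ_self _)
    have := h _ F (hF.mono fun q hq => hq.mono (affineCone_mono (by simp)))
    exact_mod_cast Nat.le_of_succ_le_succ this
  intro i
  induction i with
  | zero =>
    intro hi
    exact exists_indepOn_affineCone_of_nonempty ((p ⟨0, hi⟩).isIrreducible.nonempty.image _)
  | succ i ih =>
    intro hi
    obtain ⟨F, hF⟩ := ih (by omega)
    exact hstep _ _ (p.strictMono (by simp [Fin.lt_def])) _ F hF

/-- The image of a map in projective space. -/
def projImage {α : Type*} (φ : α → W) : Set (ℙ K W) :=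
  {x | ∃ (a : α) (h : φ a ≠ 0), x = Projectivization.mk K (φ a) h}

/-- A nonzero value is needed so that the cone is nonempty and contains `0`, which may be a value of
`φ`. -/
theorem vanishesOn_range_of_affineCone {α : Type*} {φ : α → W}
    {p : MvPolynomial (Module.Dual K W) K} (hne : ∃ a, φ a ≠ 0)
    (hp : VanishesOn p (affineCone (projImage (K := K) φ))) : VanishesOn p (Set.range φ) := by
  rintro _ ⟨a, rfl⟩
  apply hp
  by_cases h : φ a = 0
  · obtain ⟨b, hb⟩ := hne
    exact ⟨_, ⟨b, hb, rfl⟩, 0, by simp [h]⟩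
  · exact mem_affineCone_of_mk h ⟨a, h, rfl⟩

theorem affineCone_projImage_subset {α : Type*} {φ : α → W}
    (hφ : ∀ (t : K) a, ∃ b, t • φ a = φ b) :
    affineCone (projImage (K := K) φ) ⊆ Set.range φ := by
  rintro _ ⟨_, ⟨a, h, rfl⟩, t, rfl⟩
  obtain ⟨c, hc⟩ := Projectivization.exists_smul_eq_mk_rep K (φ a) h
  obtain ⟨b, hb⟩ := hφ (t * c) a
  exact ⟨b, by rw [← hc, ← hb, Units.smul_def, smul_smul]⟩

/-- The parameter ring is a domain. Two closed sets covering the image, neither containing it, would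
give nonzero pullbacks with zero product. -/
theorem IsPolyMap.isIrreducible_projImage [Infinite K] {ι : Type*} {φ : (ι → K) → W}
    (hφ : IsPolyMap φ) (hne : ∃ a, φ a ≠ 0) : IsIrreducible (projImage (K := K) φ) := by
  obtain ⟨Φ, hΦ⟩ := hφ.exists_pullback
  obtain ⟨a, ha⟩ := hne
  refine ⟨⟨_, a, ha, rfl⟩, isPreirreducible_iff_isClosed_union_isClosed.2 fun Y Z hY hZ hYZ => ?_⟩
  by_contra hcon
  simp only [not_or, Set.not_subset] at hcon
  obtain ⟨⟨y, hy, hyY⟩, ⟨z, hz, hzZ⟩⟩ := hcon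
  obtain ⟨p, ⟨d, hd⟩, hp, hpy⟩ := exists_vanishesOn_affineCone hY hyY
  obtain ⟨q, ⟨e, he⟩, hq, hqz⟩ := exists_vanishesOn_affineCone hZ hzZ
  obtain ⟨ℓ, hℓ⟩ := Module.Projective.exists_dual_eq_one K ha
  have hnz : ∀ (r : MvPolynomial (Module.Dual K W) K) (d : ℕ), r.IsHomogeneous d →
      ∀ u ∈ projImage (K := K) φ, polyEval r u.rep ≠ 0 → Φ r ≠ 0 := by
    rintro r d hr _ ⟨b, hb, rfl⟩ hne h0
    obtain ⟨c, hc⟩ := Projectivization.exists_smul_eq_mk_rep K (φ b) hb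
    apply hne
    rw [← hc, Units.smul_def, polyEval_smul_of_isHomogeneous hr, ← hΦ, h0, map_zero, mul_zero]
  -- Parameters with `φ b = 0` define no projective point; the factor `ℓ`, nonzero at `φ a`, takes
  -- care of them.
  have hprod : Φ p * Φ q * Φ (MvPolynomial.X ℓ) = 0 := by
    apply MvPolynomial.funext
    intro b
    rw [map_mul, map_mul, hΦ, hΦ, hΦ, map_zero]
    by_cases hb : φ b = 0
    · simp [polyEval, hb]
    · rcases hYZ ⟨b, hb, rfl⟩ with h | h
      · rw [hp _ (mem_affineCone_of_mk hb h), zero_mul, zero_mul]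
      · rw [hq _ (mem_affineCone_of_mk hb h), mul_zero, zero_mul]
  rcases mul_eq_zero.1 hprod with h | h
  · rcases mul_eq_zero.1 h with h | h
    · exact hnz p d hd y hy hpy h
    · exact hnz q e he z hz hqz h
  · have := hΦ (MvPolynomial.X ℓ) a
    rw [h] at this
    simp [polyEval, hℓ] at this

/-- A closed set containing the image of a polynomial map of rank `D` at the origin has dimension
at least `D`. -/
theorem le_projDim_of_affine_lines [CharZero K] {Z : Set (ℙ K W)} (hZ : IsClosed Z) {D : ℕ}
    {φ : (Fin D → K) → W} (hφ : IsPolyMap φ) (hsub : projImage φ ⊆ Z) (w : Fin D → W)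
    (hw : ∀ j t, φ (Pi.single j t) = φ 0 + t • w j) (ℓ₀ : Module.Dual K W)
    (ℓ : Fin D → Module.Dual K W) (h00 : ℓ₀ (φ 0) = 1) (h0w : ∀ j, ℓ₀ (w j) = 0)
    (hℓ0 : ∀ i, ℓ i (φ 0) = 0) (hℓ : ∀ i j, ℓ i (w j) = if i = j then 1 else 0) :
    (D : WithBot ℕ∞) ≤ projDim Z := by
  have hφ0 : φ 0 ≠ 0 := fun h => by simp [h] at h00
  -- `y 0` is reserved for scaling; the other `j` entries fill the first `j` coordinates, the rest
  -- being `0`. Thus `ψ j` parametrizes a cone with `j + 1` parameters.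
  let ext (j : ℕ) (y : Fin (j + 1) → K) : Fin D → K := fun i =>
    if h : (i : ℕ) < j then y ⟨i + 1, by omega⟩ else 0
  let ψ (j : ℕ) (y : Fin (j + 1) → K) : W := y 0 • φ (ext j y)
  have hψ : ∀ j, IsPolyMap (ψ j) := fun j => by
    refine (IsPolyMap.coord 0).smul (hφ.comp fun i => ?_)
    by_cases h : (i : ℕ) < j
    · simpa [ext, h] using IsPolyMap.coord _
    · simpa [ext, h] using IsPolyMap.const 0
  have hbase : ∀ j, ext j (Pi.single 0 1) = 0 := fun j => by
    funext i
    by_cases h : (i : ℕ) < j <;> simp [ext, h, Fin.ext_iff]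
  have hψ0 : ∀ j, ψ j (Pi.single 0 1) = φ 0 := fun j => by
    simp [ψ, hbase]
  have hne : ∀ j, ∃ y, ψ j y ≠ 0 := fun j => ⟨_, by rw [hψ0]; exact hφ0⟩
  have hscale : ∀ j (t : K) y, ∃ y', t • ψ j y = ψ j y' := fun j t y => by
    refine ⟨Function.update y 0 (t * y 0), ?_⟩
    have : ext j (Function.update y 0 (t * y 0)) = ext j y := by
      funext i
      by_cases h : (i : ℕ) < j <;> simp [ext, h, Fin.ext_iff]
    simp only [ψ, this, Function.update_self, smul_smul]
  have hmono : ∀ j, projImage (K := K) (ψ j) ⊆ projImage (ψ (j + 1)) := by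
    rintro j _ ⟨y, hy, rfl⟩
    have : ψ j y = ψ (j + 1) (Fin.snoc (α := fun _ => K) y 0) := by
      have h0 : (Fin.snoc (α := fun _ => K) y 0 : Fin (j + 2) → K) 0 = y 0 := by
        rw [show (0 : Fin (j + 2)) = Fin.castSucc 0 from rfl, Fin.snoc_castSucc]
      have he : ext (j + 1) (Fin.snoc (α := fun _ => K) y 0) = ext j y := by
        funext i
        by_cases h : (i : ℕ) < j
        · simp [ext, h, Nat.lt_succ_of_lt h, Fin.snoc]
        · by_cases h' : (i : ℕ) < j + 1 <;> simp [ext, h, h', Fin.snoc]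
      simp only [ψ, h0, he]
    exact ⟨_, this ▸ hy, by simp only [this]⟩
  have himage : ∀ j, projImage (K := K) (ψ j) ⊆ Z := by
    rintro j _ ⟨y, hy, rfl⟩
    refine hsub ⟨ext j y, right_ne_zero_of_smul hy, ?_⟩
    rw [Projectivization.mk_eq_mk_iff']
    exact ⟨y 0, rfl⟩
  have hclZ : ∀ j, closure (projImage (K := K) (ψ j)) ⊆ Z := fun j =>
    closure_minimal (himage j) hZ
  have hlt : ∀ j < D, closure (projImage (K := K) (ψ j)) ⊂ closure (projImage (ψ (j + 1))) := by
    intro j hj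
    refine (closure_mono (hmono j)).ssubset_of_ne fun heq => ?_
    -- If the closures agreed, the `j + 2` independent forms on the image of `ψ (j + 1)` would be
    -- independent on that of `ψ j`, which has `j + 1` parameters.
    let w' : Fin (j + 1 + 1) → W := Fin.cons (φ 0) fun i => w (Fin.castLE hj i)
    let ℓ' : Fin (j + 1 + 1) → Module.Dual K W := Fin.cons ℓ₀ fun i => ℓ (Fin.castLE hj i)
    have hind := (hψ (j + 1)).indepOn_range (Pi.single 0 1) w' (fun i t => ?_) ℓ' ?_
    · have := hind.le_card (hψ j) fun p hp => ?_
      · simp at this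
      · apply vanishesOn_range_of_affineCone (hne (j + 1))
        refine VanishesOn.mono ?_ (affineCone_mono subset_closure)
        rw [← heq]
        exact (hp.mono (affineCone_projImage_subset (hscale j))).affineCone_closure
    · rw [hψ0]
      refine Fin.cases ?_ (fun i => ?_) i
      · have : ext (j + 1) (Pi.single 0 1 + Pi.single 0 t) = 0 := by
          funext i
          by_cases h : (i : ℕ) < j + 1 <;> simp [ext, h, Fin.ext_iff]
        simp [ψ, this, w', add_smul]
      · have : ext (j + 1) (Pi.single 0 1 + Pi.single i.succ t) =
            Pi.single (Fin.castLE hj i) t := by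
          funext i'
          by_cases h : (i' : ℕ) < j + 1
          · simp [ext, h, Pi.single_apply, Fin.ext_iff]
          · have : (i' : ℕ) ≠ i := by omega
            simp [ext, h, Fin.ext_iff, this]
        have h0 : (Pi.single 0 1 + Pi.single i.succ t : Fin (j + 1 + 1) → K) 0 = 1 := by
          simp [(Fin.succ_ne_zero i).symm]
        simp only [ψ, this, w', hw, h0, one_smul, Fin.cons_succ]
    · intro a b
      refine Fin.cases ?_ (fun a => ?_) a <;> refine Fin.cases ?_ (fun b => ?_) b
      · simpa [ℓ', w'] using h00
      · rw [if_neg (Fin.succ_ne_zero b).symm]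
        exact h0w _
      · rw [if_neg (Fin.succ_ne_zero a)]
        exact hℓ0 _
      · simp only [ℓ', w', Fin.cons_succ, hℓ, Fin.succ_inj, Fin.castLE_inj]
  let C (j : ℕ) : TopologicalSpace.IrreducibleCloseds Z :=
    { carrier := Subtype.val ⁻¹' closure (projImage (ψ j))
      isIrreducible' := by
        have hirr := ((hψ j).isIrreducible_projImage (hne j)).closure
        obtain ⟨x, hx⟩ := hirr.nonempty
        refine ⟨⟨⟨x, hclZ j hx⟩, hx⟩, isPreirreducible_iff_isClosed_union_isClosed.2 ?_⟩
        intro A B hA hB hAB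
        obtain ⟨A, hA', rfl⟩ := isClosed_induced_iff.1 hA
        obtain ⟨B, hB', rfl⟩ := isClosed_induced_iff.1 hB
        have := isPreirreducible_iff_isClosed_union_isClosed.1 hirr.2 A B hA' hB' fun z hz =>
          hAB (show (⟨z, hclZ j hz⟩ : Z) ∈ _ from hz)
        exact this.imp (fun h z hz => h hz) (fun h z hz => h hz)
      isClosed' := isClosed_closure.preimage continuous_subtype_val }
  let p : LTSeries (TopologicalSpace.IrreducibleCloseds Z) :=
    { length := D
      toFun := fun j => C j
      step := fun j => by
        have hj := hlt j j.2
        change (C j : Set Z) ⊂ (C (j + 1) : Set Z)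
        refine ⟨fun x hx => hj.subset hx, fun h => hj.not_subset fun x hx => ?_⟩
        exact h (show (⟨x, hclZ _ hx⟩ : Z) ∈ _ from hx) }
  exact Order.LTSeries.length_le_krullDim p

/-- The dimension of the closure of a set in projective space whose cone is parametrized, up to
Zariski closure, by a polynomial map that is an immersion at some point. -/
theorem projDim_closure_eq [CharZero K] {ι : Type*} [Fintype ι] [DecidableEq ι] {S : Set (ℙ K W)}
    {φ : (ι → K) → W} (hφ : IsPolyMap φ) (hsub : projImage φ ⊆ closure S)
    (hdense : ∀ p : MvPolynomial (Module.Dual K W) K, VanishesOn p (Set.range φ) →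
      VanishesOn p (affineCone S))
    (y : ι → K) (w : ι → W) (hw : ∀ j t, φ (y + Pi.single j t) = φ y + t • w j)
    (ℓ : ι → Module.Dual K W) (hℓ : ∀ i j, ℓ i (w j) = if i = j then 1 else 0) (i₀ : ι)
    (hi₀ : ℓ i₀ (φ y) ≠ 0) {D : ℕ} (hD : Fintype.card ι = D + 1) :
    projDim (closure S) = D := by
  apply le_antisymm
  · apply projDim_le_of_indepOn_le
    intro r F hF
    rw [← hD]
    exact hF.le_card hφ fun p hp => (hdense p hp).affineCone_closure
  · let e' : Option (Fin D) ≃ ι := Fintype.equivOfCardEq (by simp [hD])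
    let e : Option (Fin D) ≃ ι := e'.trans (Equiv.swap (e' none) i₀)
    have he : e none = i₀ := by simp [e]
    -- The coordinate `i₀` is frozen at its base value; scaling will replace it.
    let emb (x : Fin D → K) : ι → K := fun i => y i + (e.symm i).elim 0 x
    have hemb0 : emb 0 = y := by
      funext i
      simp only [emb]
      cases e.symm i <;> simp
    have hembs : ∀ j t, emb (Pi.single j t) = y + Pi.single (e (some j)) t := by
      intro j t
      funext i
      obtain ⟨o, rfl⟩ := e.surjective i
      cases o <;> simp [emb, Pi.single_apply]
    have hne : ∀ i, e (some i) ≠ i₀ := fun i h => by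
      rw [← he] at h
      simpa using e.injective h
    set c := ℓ i₀ (φ y)
    -- The forms are corrected by multiples of `ℓ i₀` to vanish at `φ y`. Their values on the
    -- remaining `w j` do not change, as `ℓ i₀` is zero there.
    refine le_projDim_of_affine_lines isClosed_closure (φ := fun x => φ (emb x))
      (hφ.comp fun i => (IsPolyMap.const _).add ?_) ?_ (fun j => w (e (some j))) (fun j t => ?_)
      (c⁻¹ • ℓ i₀) (fun i => ℓ (e (some i)) - (ℓ (e (some i)) (φ y) * c⁻¹) • ℓ i₀) ?_ (fun j => ?_)
      (fun i => ?_) fun i j => ?_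
    · cases h : e.symm i with
      | none => exact IsPolyMap.const 0
      | some k => exact IsPolyMap.coord k
    · rintro _ ⟨a, ha, rfl⟩
      exact hsub ⟨_, ha, rfl⟩
    · rw [hembs, hw, hemb0]
    · simp [hemb0, c, hi₀]
    · simp [hℓ, (hne j).symm]
    · simp only [hemb0, LinearMap.sub_apply, LinearMap.smul_apply, smul_eq_mul]
      change _ - _ * c⁻¹ * c = 0
      rw [inv_mul_cancel_right₀ hi₀, sub_self]
    · simp [hℓ, (hne j).symm]

end Dimension

/-! ### Sums of decomposable vectors and secant varieties -/

section WedgeSum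

variable {K V : Type*} [Field K] [AddCommGroup V] [Module K V] {k : ℕ}

/-- `T` is a sum of `r` decomposable exterior vectors. -/
def IsWedgeSum (r : ℕ) (T : ⋀[K]^k V) : Prop :=
  ∃ v : Fin r → Fin k → V, T = ∑ l, exteriorPower.ιMulti K k (v l)

theorem IsWedgeSum.add_ιMulti {r : ℕ} {T : ⋀[K]^k V} (h : IsWedgeSum r T) (w : Fin k → V) :
    IsWedgeSum (r + 1) (exteriorPower.ιMulti K k w + T) := by
  obtain ⟨v, rfl⟩ := h
  exact ⟨Fin.cons w v, by simp [Fin.sum_univ_succ]⟩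

theorem IsWedgeSum.mono (hk : 0 < k) {r r' : ℕ} (hr : r ≤ r') {T : ⋀[K]^k V}
    (h : IsWedgeSum r T) : IsWedgeSum r' T := by
  induction r', hr using Nat.le_induction with
  | base => exact h
  | succ m _ ih =>
    have : exteriorPower.ιMulti K k (0 : Fin k → V) = 0 :=
      (exteriorPower.ιMulti K k).map_coord_zero ⟨0, hk⟩ rfl
    simpa [this] using ih.add_ιMulti 0

theorem smul_ιMulti (hk : 0 < k) (c : K) (v : Fin k → V) :
    ∃ v', c • exteriorPower.ιMulti K k v = exteriorPower.ιMulti K k v' := by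
  refine ⟨Function.update v ⟨0, hk⟩ (c • v ⟨0, hk⟩), ?_⟩
  rw [AlternatingMap.map_update_smul, Function.update_eq_self]

theorem IsWedgeSum.smul (hk : 0 < k) {r : ℕ} {T : ⋀[K]^k V} (h : IsWedgeSum r T) (c : K) :
    IsWedgeSum r (c • T) := by
  obtain ⟨v, rfl⟩ := h
  choose v' hv' using fun l => smul_ιMulti hk c (v l)
  exact ⟨v', by rw [Finset.smul_sum]; exact Finset.sum_congr rfl fun l _ => hv' l⟩

/-- A shorter sum can be padded with zero wedges, which exist because `k > 0`. -/
theorem wedgeRank_le_iff (hk : 0 < k) {r : ℕ} {T : ⋀[K]^k V} :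
    wedgeRank T ≤ r ↔ IsWedgeSum r T := by
  refine ⟨fun h => ?_, fun h => iInf₂_le r h⟩
  by_contra hcon
  have : ((r + 1 : ℕ) : ℕ∞) ≤ wedgeRank T := by
    refine le_iInf₂ fun r' hr' => ?_
    by_contra hlt
    rw [Nat.cast_le, not_le, Nat.lt_succ_iff] at hlt
    exact hcon (IsWedgeSum.mono hk hlt hr')
  have := this.trans h
  rw [Nat.cast_le] at this
  omega

/-- The union of the linear spaces spanned by `s` points. -/
def secantUnion {W : Type*} [AddCommGroup W] [Module K W] (X : Set (ℙ K W)) (s : ℕ) :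
    Set (ℙ K W) :=
  ⋃ P : Fin s → X,
    (Projectivization.Subspace.span (Set.range fun i => (P i : ℙ K W)) : Set (ℙ K W))

/-- A point of the span is a linear combination of the `s` decomposables, and each coefficient is
absorbed into a factor. -/
theorem isWedgeSum_of_mem_affineCone_secantUnion (hk : 0 < k) {s : ℕ} {T : ⋀[K]^k V}
    (hT : T ∈ affineCone (secantUnion (pluckerGrassmannian K V k) s)) : IsWedgeSum s T := by
  obtain ⟨x, hx, t, rfl⟩ := hT
  apply IsWedgeSum.smul hk
  obtain ⟨P, hP⟩ := Set.mem_iUnion.1 hx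
  choose v hv _ hvP using fun l => (P l).2
  let U := Submodule.span K (Set.range fun l => exteriorPower.ιMulti K k (v l))
  have hle : Projectivization.Subspace.span (Set.range fun i => (P i : ℙ K _)) ≤
      U.projectivization := by
    rw [Projectivization.Subspace.span_le_subspace_iff]
    rintro _ ⟨l, rfl⟩
    change ((P l : pluckerGrassmannian K V k) : ℙ K (⋀[K]^k V)) ∈ _
    rw [hvP l]
    exact (Submodule.mk_mem_projectivization_iff U (hv l)).2 (Submodule.subset_span ⟨l, rfl⟩)
  have hmem := hle hP
  rw [← x.mk_rep, Submodule.mk_mem_projectivization_iff,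
    Submodule.mem_span_range_iff_exists_fun] at hmem
  obtain ⟨c, hc⟩ := hmem
  choose v' hv' using fun l => smul_ιMulti hk (c l) (v l)
  exact ⟨v', by rw [← hc]; exact Finset.sum_congr rfl fun l _ => hv' l⟩

theorem mk_mem_secantUnion {s : ℕ} {T : ⋀[K]^k V} (hT : T ≠ 0) (h : IsWedgeSum s T) :
    Projectivization.mk K T hT ∈ secantUnion (pluckerGrassmannian K V k) s := by
  classical
  obtain ⟨v, rfl⟩ := h
  obtain ⟨l₀, -, hl₀⟩ := Finset.exists_ne_zero_of_sum_ne_zero hT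
  have hX : ∀ u : Fin k → V, ∀ hu : exteriorPower.ιMulti K k u ≠ 0,
      Projectivization.mk K _ hu ∈ pluckerGrassmannian K V k := fun u hu =>
    ⟨u, hu, by_contra fun h => hu (AlternatingMap.map_linearDependent _ _ h), rfl⟩
  -- Zero summands define no point, so a nonzero summand is repeated in their place.
  let P : Fin s → pluckerGrassmannian K V k := fun l =>
    if h : exteriorPower.ιMulti K k (v l) = 0 then ⟨_, hX _ hl₀⟩ else ⟨_, hX _ h⟩
  refine Set.mem_iUnion.2 ⟨P, ?_⟩
  rw [SetLike.mem_coe, ← Projectivization.Subspace.mem_submodule_iff]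
  refine Submodule.sum_mem _ fun l _ => ?_
  by_cases h : exteriorPower.ιMulti K k (v l) = 0
  · rw [h]
    exact zero_mem _
  · rw [Projectivization.Subspace.mem_submodule_iff _ h]
    exact Projectivization.Subspace.subset_span _ ⟨l, by simp [P, h]⟩

/-- To check that a polynomial vanishes on all sums of `s` decomposable vectors, it suffices to do
so for generic vectors. -/
theorem polyEval_sum_ιMulti_eq_zero [Infinite K] [FiniteDimensional K V] {s : ℕ}
    (p : MvPolynomial (Module.Dual K (⋀[K]^k V)) K) (good : (Fin s → Fin k → V) → Prop)
    (v₀ : Fin s → Fin k → V) (hfin : ∀ v, {t : K | ¬ good (v + t • v₀)}.Finite)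
    (hp : ∀ v, good v → polyEval p (∑ l, exteriorPower.ιMulti K k (v l)) = 0)
    (v : Fin s → Fin k → V) : polyEval p (∑ l, exteriorPower.ιMulti K k (v l)) = 0 := by
  have hφ : IsPolyMap fun x : Unit → K =>
      ∑ l, exteriorPower.ιMulti K k (fun i => v l i + x () • v₀ l i) :=
    IsPolyMap.sum _ fun l _ => IsPolyMap.multilinear
      (exteriorPower.ιMulti K k).toMultilinearMap fun i =>
        (IsPolyMap.const _).add ((IsPolyMap.coord ()).smul (IsPolyMap.const _))
  have := hφ.polyEval_eq_zero_of_finite p (hfin v) (fun t ht => hp _ (not_not.1 ht)) 0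
  simpa using this

end WedgeSum

/-! ### Charts -/

section Chart

variable {K V : Type*} [Field K] [AddCommGroup V] [Module K V]

theorem Matrix.finite_setOf_det_add_smul_one_eq_zero {τ : Type*} [Fintype τ] [DecidableEq τ]
    (B : Matrix τ τ K) : {t : K | (B + t • (1 : Matrix τ τ K)).det = 0}.Finite := by
  classical
  refine ((-B).charpoly.roots.toFinset.finite_toSet).subset fun t ht => ?_
  simp only [Finset.mem_coe, Multiset.mem_toFinset, Polynomial.mem_roots
    (Matrix.charpoly_monic _).ne_zero, Polynomial.IsRoot.def, Matrix.eval_charpoly]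
  rw [← show (B + t • (1 : Matrix τ τ K)).det = 0 from ht]
  rw [sub_neg_eq_add, add_comm, Matrix.smul_one_eq_diagonal, Matrix.scalar_apply]

variable {I τ : Type*} [Fintype I] (e : Module.Basis I K V) (σ : τ → I)

/-- The block of coordinates of a family of vectors. -/
noncomputable def coordBlock (v : τ → V) : Matrix τ τ K := Matrix.of fun i j => e.repr (v i) (σ j)

/-- The family of vectors with identity block `σ` and given remaining coordinates. -/
noncomputable def chartVec [DecidablePred (· ∈ Set.range σ)]
    (b : τ → {j // j ∉ Set.range σ} → K) (i : τ) : V :=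
  e (σ i) + ∑ j, b i j • e j

variable {σ}

theorem finite_setOf_det_coordBlock_eq_zero {I : Type*} (e : Module.Basis I K V) {σ : τ → I}
    [Fintype τ] [DecidableEq τ] (hσ : Function.Injective σ) (v : τ → V) :
    {t : K | (coordBlock e σ (v + t • fun i => e (σ i))).det = 0}.Finite := by
  convert Matrix.finite_setOf_det_add_smul_one_eq_zero (coordBlock e σ v) using 5
  ext i j
  by_cases hij : i = j
  · simp [coordBlock, hij]
  · simp [coordBlock, hij, Finsupp.single_eq_of_ne (hσ.ne hij).symm]

/-- Row reduction: multiplying by the inverse of the block normalizes it to the identity. -/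
theorem exists_eq_sum_chartVec [Fintype τ] [DecidableEq τ] [DecidablePred (· ∈ Set.range σ)]
    (hσ : Function.Injective σ) (v : τ → V) (h : (coordBlock e σ v).det ≠ 0) :
    ∃ b, ∀ i, v i = ∑ j, coordBlock e σ v i j • chartVec e σ b j := by
  classical
  set B := coordBlock e σ v
  have hB : IsUnit B.det := h.isUnit
  let u : τ → V := fun i => ∑ j, B⁻¹ i j • v j
  have hu : ∀ i j, e.repr (u i) (σ j) = if i = j then 1 else 0 := by
    intro i j
    have := congrFun (congrFun (Matrix.nonsing_inv_mul B hB) i) j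
    rw [Matrix.mul_apply, Matrix.one_apply] at this
    rw [← this]
    simp [u, B, coordBlock]
  refine ⟨fun i j => e.repr (u i) j, fun i => ?_⟩
  have hchart : ∀ i, chartVec e σ (fun i j => e.repr (u i) j) i = u i := by
    intro i
    apply e.repr.injective
    ext j
    by_cases hj : j ∈ Set.range σ
    · obtain ⟨j, rfl⟩ := hj
      rw [hu]
      have : ∀ x : {j // j ∉ Set.range σ}, (x : I) ≠ σ j := fun x hx => x.2 ⟨j, hx.symm⟩
      simp [chartVec, Finsupp.single_apply, hσ.eq_iff, this]
    · have h1 : σ i ≠ j := fun hx => hj ⟨i, hx⟩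
      simp only [chartVec, map_add, map_sum, map_smul, Module.Basis.repr_self, Finsupp.coe_add,
        Finsupp.coe_finsetSum, Pi.add_apply, Finset.sum_apply, Finsupp.smul_apply,
        Finsupp.single_apply, h1, if_false, zero_add, smul_eq_mul, mul_ite, mul_one, mul_zero]
      rw [Finset.sum_eq_single (⟨j, hj⟩ : {j // j ∉ Set.range σ})]
      · simp
      · intro x _ hx
        rw [if_neg fun h => hx (Subtype.ext h)]
      · simp
  simp only [hchart, u, Finset.smul_sum, smul_smul]
  rw [Finset.sum_comm]
  simp only [← Finset.sum_smul, ← Matrix.mul_apply, Matrix.mul_nonsing_inv B hB, Matrix.one_apply,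
    ite_smul, one_smul, zero_smul]
  simp

theorem IsPolyMap.chartVec {ι : Type*} [DecidablePred (· ∈ Set.range σ)]
    (b : (ι → K) → τ → {j // j ∉ Set.range σ} → K) (hb : ∀ i j, IsPolyMap fun x => b x i j)
    (i : τ) : IsPolyMap fun x => chartVec e σ (b x) i :=
  (IsPolyMap.const _).add (IsPolyMap.sum _ fun j _ => (hb i j).smul (IsPolyMap.const _))

/-- Linear forms dual to a family of wedges of basis vectors. -/
theorem exists_dual_ιMulti_basis {K V I α : Type*} [Field K] [AddCommGroup V] [Module K V]
    (e : Module.Basis I K V) [DecidableEq α] {k : ℕ} (f : α → Fin k → I)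
    (hf : ∀ a, Function.Injective (f a)) (hr : ∀ a b, Set.range (f a) ⊆ Set.range (f b) → a = b) :
    ∃ ℓ : α → Module.Dual K (⋀[K]^k V), ∀ a b,
      ℓ a (exteriorPower.ιMulti K k fun i => e (f b i)) = if a = b then 1 else 0 := by
  classical
  refine ⟨fun a => exteriorPower.pairingDual K V k
    (exteriorPower.ιMulti K k fun i => e.coord (f a i)), fun a b => ?_⟩
  rw [exteriorPower.pairingDual_ιMulti_ιMulti]
  split_ifs with hab
  · subst hab
    convert Matrix.det_one (n := Fin k) (R := K)
    ext i j
    simp [Matrix.one_apply, Finsupp.single_apply, (hf a).eq_iff]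
  -- An index of `f a` missing from `f b` produces a zero column in the pairing matrix.
  · obtain ⟨_, ⟨i, rfl⟩, hi⟩ := Set.not_subset.1 (mt (hr a b) hab)
    have hne : ∀ j, f b j ≠ f a i := fun j hj => hi ⟨j, hj⟩
    apply Matrix.det_eq_zero_of_column_eq_zero i
    intro j
    simp [Finsupp.single_apply, hne]

/-- The wedge of linear combinations of `k` vectors is a multiple of their wedge. -/
theorem ιMulti_linearCombination {k : ℕ} (u : Fin k → V) (B : Matrix (Fin k) (Fin k) K) :
    exteriorPower.ιMulti K k (fun i => ∑ j, B i j • u j) =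
      B.det • exteriorPower.ιMulti K k u := by
  let L : (Fin k → K) →ₗ[K] V := Fintype.linearCombination K u
  have : (exteriorPower.ιMulti K k (M := V)).compLinearMap L =
      (LinearMap.toSpanSingleton K _ (exteriorPower.ιMulti K k u)).compAlternatingMap
        Matrix.detRowAlternating := by
    -- Both sides are alternating in the rows of `B`, so permutations of the standard basis suffice.
    refine (Pi.basisFun K (Fin k)).ext_alternating fun v hv => ?_
    obtain ⟨π, rfl⟩ : ∃ π : Equiv.Perm (Fin k), v = π :=
      ⟨Equiv.ofBijective v (Finite.injective_iff_bijective.1 hv), rfl⟩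
    change exteriorPower.ιMulti K k ((fun i => L (Pi.basisFun K (Fin k) i)) ∘ π) =
      (Matrix.detRowAlternating ((Pi.basisFun K (Fin k) : Fin k → Fin k → K) ∘ π)) •
        exteriorPower.ιMulti K k u
    rw [AlternatingMap.map_perm, AlternatingMap.map_perm, smul_assoc]
    have h1 : Matrix.detRowAlternating (Pi.basisFun K (Fin k) : Fin k → Fin k → K) = 1 := by
      have : (Pi.basisFun K (Fin k) : Fin k → Fin k → K) = (1 : Matrix (Fin k) (Fin k) K) := by
        funext i j
        simp [Matrix.one_apply, Pi.single_apply, eq_comm]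
      rw [this]
      exact Matrix.det_one
    rw [h1, one_smul]
    congr 2
    funext i
    simp [L, Fintype.linearCombination_apply, Pi.single_apply]
  exact congrFun (congrArg DFunLike.coe this) B

end Chart

/-! ### Secant varieties for `k ≥ 3` -/

section HigherWedge

variable {K V : Type*} [Field K] [AddCommGroup V] [Module K V]

theorem ιMulti_add_ite {k : ℕ} (x : Fin k → V) (i : Fin k) (t : K) (y : V) :
    exteriorPower.ιMulti K k (fun i' => x i' + if i' = i then t • y else 0) =
      exteriorPower.ιMulti K k x + t • exteriorPower.ιMulti K k (Function.update x i y) := by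
  have : (fun i' => x i' + if i' = i then t • y else 0) =
      Function.update x i (x i + t • y) := by
    funext i'
    by_cases h : i' = i
    · subst h
      simp
    · simp [h]
  rw [this, AlternatingMap.map_update_add, AlternatingMap.map_update_smul, Function.update_eq_self]

variable {I : Type*} [Fintype I] (e : Module.Basis I K V)

/-- A family of vectors in a chart, with a single nonzero coordinate. -/
theorem chartVec_single {τ : Type*} {σ : τ → I} [DecidableEq τ] [DecidableEq I]
    [DecidablePred (· ∈ Set.range σ)] (i : τ) (j : {j // j ∉ Set.range σ}) (t : K)
    (b : τ → {j // j ∉ Set.range σ} → K)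
    (hb : ∀ i' j', b i' j' = if (i', j') = (i, j) then t else 0) (i' : τ) :
    chartVec e σ b i' = e (σ i') + if i' = i then t • e j else 0 := by
  by_cases h : i' = i <;> simp [chartVec, hb, h]

theorem chartVec_zero {τ : Type*} {σ : τ → I} [DecidablePred (· ∈ Set.range σ)]
    (b : τ → {j // j ∉ Set.range σ} → K) (hb : ∀ i' j', b i' j' = 0) (i : τ) :
    chartVec e σ b i = e (σ i) := by
  simp [chartVec, hb]

theorem IsPolyMap.ιMulti {ι : Type*} [FiniteDimensional K V] {k : ℕ} {v : Fin k → (ι → K) → V}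
    (hv : ∀ i, IsPolyMap (v i)) :
    IsPolyMap fun x => exteriorPower.ιMulti K k (fun i => v i x) :=
  IsPolyMap.multilinear (exteriorPower.ιMulti K k).toMultilinearMap hv

theorem card_compl_range {τ : Type*} [Fintype τ] [DecidableEq I] {σ : τ → I}
    (hσ : Function.Injective σ) :
    Fintype.card {j // j ∉ Set.range σ} = Fintype.card I - Fintype.card τ := by
  classical
  rw [Fintype.card_subtype_compl, ← Set.card_range_of_injective hσ]

/-- The index families of the tangent vectors at a sum of wedges of disjoint blocks. -/
def tangentIndex {I : Type*} {s k : ℕ} [DecidableEq I] (σ : Fin s × Fin k → I) :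
    (Σ l : Fin s, Option (Fin k × {j // j ∉ Set.range fun i => σ (l, i)})) → Fin k → I
  | ⟨l, none⟩ => fun i => σ (l, i)
  | ⟨l, some (i, j)⟩ => Function.update (fun i => σ (l, i)) i j

theorem tangentIndex_injective {I : Type*} {s k : ℕ} [DecidableEq I] {σ : Fin s × Fin k → I}
    (hσ : Function.Injective σ) (a) : Function.Injective (tangentIndex σ a) := by
  obtain ⟨l, _ | ⟨i, j, hj⟩⟩ := a
  · intro x y hxy
    simpa using hσ hxy
  · have hj' : ∀ x, σ (l, x) ≠ j := fun x hx => hj ⟨x, hx⟩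
    intro x y hxy
    by_cases hx : x = i <;> by_cases hy : y = i
    · rw [hx, hy]
    · subst hx
      simp [tangentIndex, hy] at hxy
      exact absurd hxy.symm (hj' y)
    · subst hy
      simp [tangentIndex, hx] at hxy
      exact absurd hxy (hj' x)
    · simp [tangentIndex, hx, hy] at hxy
      simpa using hσ hxy

/-- This is where `k ≥ 3` enters. The family `a` keeps at least `k - 1 ≥ 2` indices of its block,
while `b` has at most one index outside its own, so the blocks agree. Within a block, the new index
and the missing index determine the family. -/
theorem eq_of_range_tangentIndex_subset {I : Type*} {s k : ℕ} [DecidableEq I] {σ : Fin s × Fin k → I}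
    (hk : 3 ≤ k) (hσ : Function.Injective σ) (a b)
    (h : Set.range (tangentIndex σ a) ⊆ Set.range (tangentIndex σ b)) : a = b := by
  -- An index of `b` outside its block is the exceptional one.
  have hout : ∀ l o x, (∀ y, σ (l, y) ≠ x) → x ∈ Set.range (tangentIndex σ ⟨l, o⟩) →
      ∃ i j, o = some (i, j) ∧ (j : I) = x := by
    rintro l (_ | ⟨i, j⟩) x hx ⟨y, hy⟩
    · exact absurd hy (hx y)
    · refine ⟨i, j, rfl, ?_⟩
      by_cases hyi : y = i
      · subst hyi
        simpa [tangentIndex] using hy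
      · simp [tangentIndex, hyi] at hy
        exact absurd hy (hx y)
  -- All indices of the block but the exceptional one occur.
  have hin : ∀ l o y, (∀ i j, o = some (i, j) → y ≠ i) →
      σ (l, y) ∈ Set.range (tangentIndex σ ⟨l, o⟩) := by
    rintro l (_ | ⟨i, j⟩) y hy
    · exact ⟨y, rfl⟩
    · exact ⟨y, by simp [tangentIndex, hy i j rfl]⟩
  -- The replaced index does not occur.
  have hnot : ∀ l i j, σ (l, i) ∉ Set.range (tangentIndex σ ⟨l, some (i, j)⟩) := by
    rintro l i ⟨j, hj⟩ ⟨y, hy⟩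
    by_cases hyi : y = i
    · subst hyi
      simp [tangentIndex] at hy
      exact hj ⟨y, hy.symm⟩
    · simp [tangentIndex, hyi] at hy
      exact hyi (by simpa using hσ hy)
  obtain ⟨l, o⟩ := a
  obtain ⟨l', o'⟩ := b
  have hl : l = l' := by
    by_contra hne
    obtain ⟨y, z, hyz, hy, hz⟩ : ∃ y z : Fin k, y ≠ z ∧ (∀ i j, o = some (i, j) → y ≠ i) ∧
        (∀ i j, o = some (i, j) → z ≠ i) := by
      obtain ⟨i₀, hi₀⟩ : ∃ i₀ : Fin k, ∀ i j, o = some (i, j) → i = i₀ := by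
        rcases o with _ | ⟨i, j⟩
        · exact ⟨⟨0, by omega⟩, by simp⟩
        · exact ⟨i, by simp +contextual⟩
      have hc : 2 ≤ (Finset.univ.erase i₀).card := by
        rw [Finset.card_erase_of_mem (Finset.mem_univ _), Finset.card_univ, Fintype.card_fin]
        omega
      obtain ⟨y, hy, z, hz, hyz⟩ := Finset.one_lt_card.1 hc
      exact ⟨y, z, hyz, fun i j hij => hi₀ i j hij ▸ Finset.ne_of_mem_erase hy,
        fun i j hij => hi₀ i j hij ▸ Finset.ne_of_mem_erase hz⟩
    have hd : ∀ x y, σ (l', x) ≠ σ (l, y) := fun x y hxy => hne (by simpa using (congrArg Prod.fst (hσ hxy)).symm)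
    obtain ⟨i, j, hij, hj⟩ := hout l' o' _ (fun x => hd x y) (h (hin l o y hy))
    obtain ⟨i', j', hij', hj'⟩ := hout l' o' _ (fun x => hd x z) (h (hin l o z hz))
    rw [hij] at hij'
    obtain ⟨rfl, rfl⟩ : i = i' ∧ j = j' := by simpa using hij'
    exact hyz (by simpa using hσ (hj.symm.trans hj'))
  subst hl
  congr 1
  rcases o with _ | ⟨i, j⟩
  · rcases o' with _ | ⟨i', j'⟩
    · rfl
    · exact absurd (h (hin l none i' (by simp))) (hnot l i' j')
  · have hj : (j : I) ∈ Set.range (tangentIndex σ ⟨l, some (i, j)⟩) :=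
      ⟨i, by simp [tangentIndex]⟩
    obtain ⟨i', j', rfl, hjj⟩ := hout l o' j (fun y hy => j.2 ⟨y, hy⟩) (h hj)
    obtain rfl : j' = j := Subtype.ext hjj
    by_cases hii : i' = i
    · rw [hii]
    · exact absurd (h (hin l _ i' (by
        rintro i₁ j₁ h₁ rfl
        simp only [Option.some.injEq, Prod.mk.injEq] at h₁
        exact hii h₁.1.symm))) (hnot l i' j')

/-- Each block contributes a scalar and `k (dim V - k)` chart coordinates. The independent tangent
vectors also bound `D + 1` by the ambient dimension, which decides the minimum in the expected
dimension. -/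
theorem projDim_secantVariety_of_three_le [CharZero K] [FiniteDimensional K V] {I : Type*}
    [Fintype I] [DecidableEq I] (e : Module.Basis I K V)
    {s k D : ℕ} (hk : 3 ≤ k) (hs : 1 ≤ s) {σ : Fin s × Fin k → I} (hσ : Function.Injective σ)
    (hD : s * (k * (Fintype.card I - k) + 1) = D + 1) :
    projDim (secantVariety (pluckerGrassmannian K V k) s) = D ∧
      D + 1 ≤ Module.finrank K (⋀[K]^k V) := by
  classical
  let ι := Σ l : Fin s, Option (Fin k × {j // j ∉ Set.range fun i => σ (l, i)})
  have hinj : ∀ l, Function.Injective fun i => σ (l, i) := fun l x y hxy => by simpa using hσ hxy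
  have hcard : Fintype.card ι = D + 1 := by
    rw [← hD]
    simp only [ι, Fintype.card_sigma, Fintype.card_option, Fintype.card_prod, Fintype.card_fin,
      card_compl_range (hinj _), Finset.sum_const, Finset.card_univ, smul_eq_mul]
  obtain ⟨ℓ, hℓ⟩ := exists_dual_ιMulti_basis e (tangentIndex σ) (tangentIndex_injective hσ)
    (eq_of_range_tangentIndex_subset hk hσ)
  let w : ι → ⋀[K]^k V := fun a => exteriorPower.ιMulti K k fun i => e (tangentIndex σ a i)
  let g (l : Fin s) (z : Option (Fin k × {j // j ∉ Set.range fun i => σ (l, i)}) → K) :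
      ⋀[K]^k V := z none • exteriorPower.ιMulti K k
        (chartVec e (fun i => σ (l, i)) fun i j => z (some (i, j)))
  let φ : (ι → K) → ⋀[K]^k V := fun x => ∑ l, g l fun o => x ⟨l, o⟩
  let y : ι → K := fun a => if a.2 = none then 1 else 0
  have hφ : IsPolyMap φ := IsPolyMap.sum _ fun l _ => (IsPolyMap.coord _).smul
    (IsPolyMap.ιMulti fun i => IsPolyMap.chartVec e _ (fun i j => IsPolyMap.coord _) i)
  have hg : ∀ l o t, g l (fun o' => y ⟨l, o'⟩ + Pi.single (M := fun _ => K) o t o') =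
      g l (fun o' => y ⟨l, o'⟩) + t • w ⟨l, o⟩ := by
    rintro l (_ | ⟨i, j⟩) t
    · have h0 : ∀ b : Fin k → {j // j ∉ Set.range fun i => σ (l, i)} → K,
          (∀ i j, b i j = 0) → chartVec e (fun i => σ (l, i)) b = fun i => e (σ (l, i)) :=
        fun b hb => funext fun i => chartVec_zero e b hb i
      simp only [g]
      rw [h0 _ (by simp [y]), h0 _ (by simp [y])]
      simp [y, w, tangentIndex, add_smul]
    · simp only [g]
      have h1 : (chartVec e (fun i => σ (l, i)) fun i' j' => y ⟨l, some (i', j')⟩ +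
          Pi.single (M := fun _ => K) (some (i, j)) t (some (i', j'))) =
          fun i' => e (σ (l, i')) + if i' = i then t • e j else 0 :=
        funext fun i' => chartVec_single e i j t _ (fun i' j' => by simp [y, Pi.single_apply]) i'
      have h0 : (chartVec e (fun i => σ (l, i)) fun i' j' => y ⟨l, some (i', j')⟩) =
          fun i' => e (σ (l, i')) :=
        funext fun i' => chartVec_zero e _ (fun i' j' => by simp [y]) i'
      rw [h1, h0, ιMulti_add_ite]
      simp only [y, w, tangentIndex]
      simp only [reduceCtorEq, if_true, ne_eq, not_false_eq_true, Pi.single_eq_of_ne, add_zero,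
        one_smul]
      congr 3
      funext i'
      by_cases h : i' = i
      · subst h
        simp
      · simp [h]
  have hw : ∀ a t, φ (y + Pi.single a t) = φ y + t • w a := by
    rintro ⟨l, o⟩ t
    simp only [φ]
    rw [← Finset.add_sum_erase _ _ (Finset.mem_univ l), ← Finset.add_sum_erase (a := l) _
      (fun l => g l fun o => y ⟨l, o⟩) (Finset.mem_univ l), add_right_comm]
    congr 1
    · rw [← hg l o t]
      have : (fun o' => (y + Pi.single ⟨l, o⟩ t : ι → K) ⟨l, o'⟩) =
          fun o' => y ⟨l, o'⟩ + Pi.single (M := fun _ => K) o t o' := funext fun o' => ?_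
      · exact congrArg (g l) this
      by_cases h : o' = o
      · subst h
        simp
      · have hne : (⟨l, o'⟩ : ι) ≠ ⟨l, o⟩ := fun hh => h (by simpa using hh)
        simp [Pi.single_eq_of_ne hne, h]
    · refine Finset.sum_congr rfl fun l' hl' => ?_
      have : (fun o' => (y + Pi.single ⟨l, o⟩ t : ι → K) ⟨l', o'⟩) =
          fun o' => y ⟨l', o'⟩ := funext fun o' => ?_
      · exact congrArg (g l') this
      have : (⟨l', o'⟩ : ι) ≠ ⟨l, o⟩ := fun h => Finset.ne_of_mem_erase hl' (congrArg Sigma.fst h)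
      simp [Pi.single_eq_of_ne this]
  have hφy : φ y = ∑ l, w ⟨l, none⟩ := by
    refine Finset.sum_congr rfl fun l _ => ?_
    simp only [g]
    have h0 : (chartVec e (fun i => σ (l, i)) fun i' j' => y ⟨l, some (i', j')⟩) =
        fun i' => e (σ (l, i')) :=
      funext fun i' => chartVec_zero e _ (fun i' j' => by simp [y]) i'
    rw [h0]
    simp [y, w, tangentIndex]
  constructor
  · refine projDim_closure_eq (S := secantUnion (pluckerGrassmannian K V k) s) hφ ?_ ?_ y w hw ℓ
      hℓ ⟨⟨0, hs⟩, none⟩ ?_ hcard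
    · rintro _ ⟨x, hx, rfl⟩
      refine subset_closure (mk_mem_secantUnion hx ?_)
      choose v hv using fun l => smul_ιMulti (V := V) (by omega : 0 < k) (x ⟨l, none⟩)
        (chartVec e (fun i => σ (l, i)) fun i j => x ⟨l, some (i, j)⟩)
      exact ⟨v, Finset.sum_congr rfl fun l _ => hv l⟩
    · intro p hp T hT
      obtain ⟨v, rfl⟩ := isWedgeSum_of_mem_affineCone_secantUnion (by omega) hT
      -- Generically all `s` blocks are invertible; each wedge is then its block determinant times
      -- the wedge of chart vectors.
      refine polyEval_sum_ιMulti_eq_zero p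
        (fun v => ∀ l, (coordBlock e (fun i => σ (l, i)) (v l)).det ≠ 0)
        (fun l i => e (σ (l, i))) (fun v => ?_) (fun v hv => ?_) v
      · refine (Set.finite_iUnion fun l =>
          finite_setOf_det_coordBlock_eq_zero e (hinj l) (v l)).subset fun t ht => ?_
        simp only [Set.mem_ofPred_eq, not_forall, not_not] at ht
        obtain ⟨l, hl⟩ := ht
        exact Set.mem_iUnion.2 ⟨l, hl⟩
      · choose b hb using fun l => exists_eq_sum_chartVec e (hinj l) (v l) (hv l)
        apply hp
        refine ⟨fun a => match a with
          | ⟨l, none⟩ => (coordBlock e (fun i => σ (l, i)) (v l)).det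
          | ⟨l, some (i, j)⟩ => b l i j, ?_⟩
        refine Finset.sum_congr rfl fun l _ => ?_
        simp only [g]
        rw [show v l = fun i => ∑ j, coordBlock e (fun i => σ (l, i)) (v l) i j •
          chartVec e (fun i => σ (l, i)) (b l) j from funext (hb l), ιMulti_linearCombination]
        rw [← show v l = fun i => ∑ j, coordBlock e (fun i => σ (l, i)) (v l) i j •
          chartVec e (fun i => σ (l, i)) (b l) j from funext (hb l)]
    · rw [hφy, map_sum]
      simp only [w, hℓ]
      rw [Finset.sum_eq_single_of_mem ⟨0, hs⟩ (Finset.mem_univ _)]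
      · simp
      · intro l _ hl
        rw [if_neg]
        intro h
        exact hl (congrArg Sigma.fst h).symm
  · rw [← hcard]
    have hli : LinearIndependent K w := by
      rw [Fintype.linearIndependent_iff]
      intro c hc a
      have := congrArg (ℓ a) hc
      simp only [map_sum, map_smul, w, hℓ, map_zero, smul_eq_mul, mul_ite, mul_one, mul_zero] at this
      rw [Finset.sum_eq_single_of_mem a (Finset.mem_univ a) fun b _ hb => if_neg hb.symm] at this
      simpa using this
    exact hli.fintype_card_le_finrank

end HigherWedge

/-! ### Normal form of exterior `2`-vectors -/

section TwoVectors

variable {K V : Type*} [Field K] [AddCommGroup V] [Module K V]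

theorem update_vecCons_zero {V : Type*} (a b c : V) : Function.update ![a, b] 0 c = ![c, b] := by
  ext i
  fin_cases i <;> rfl

theorem update_vecCons_one {V : Type*} (a b c : V) : Function.update ![a, b] 1 c = ![a, c] := by
  ext i
  fin_cases i <;> rfl

variable (K) in
/-- The wedge of two vectors, as a bilinear map. -/
noncomputable def wedgePair : V →ₗ[K] V →ₗ[K] ⋀[K]^2 V :=
  LinearMap.mk₂ K (fun a b => exteriorPower.ιMulti K 2 ![a, b])
    (fun a a' b => by
      have := (exteriorPower.ιMulti K 2).map_update_add ![a, b] 0 a a'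
      rwa [update_vecCons_zero, update_vecCons_zero, update_vecCons_zero] at this)
    (fun c a b => by
      have := (exteriorPower.ιMulti K 2).map_update_smul ![a, b] 0 c a
      rwa [update_vecCons_zero, update_vecCons_zero] at this)
    (fun a b b' => by
      have := (exteriorPower.ιMulti K 2).map_update_add ![a, b] 1 b b'
      rwa [update_vecCons_one, update_vecCons_one, update_vecCons_one] at this)
    (fun c a b => by
      have := (exteriorPower.ιMulti K 2).map_update_smul ![a, b] 1 c b
      rwa [update_vecCons_one, update_vecCons_one] at this)

theorem ιMulti_two (v : Fin 2 → V) : exteriorPower.ιMulti K 2 v = wedgePair K (v 0) (v 1) := by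
  simp only [wedgePair, LinearMap.mk₂_apply]
  congr 1
  ext i
  fin_cases i <;> rfl

theorem wedgePair_self (a : V) : wedgePair K a a = 0 :=
  (exteriorPower.ιMulti K 2).map_eq_zero_of_eq ![a, a] (i := 0) (j := 1) rfl (by simp)

theorem wedgePair_swap (a b : V) : wedgePair K a b = -wedgePair K b a := by
  have := wedgePair_self (K := K) (a + b)
  simp only [map_add, LinearMap.add_apply, wedgePair_self, zero_add, add_zero] at this
  rw [eq_neg_iff_add_eq_zero, add_comm]
  exact this

/-- The image of `⋀² U` in `⋀² V`. -/
def wedgeSquare (U : Submodule K V) : Submodule K (⋀[K]^2 V) :=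
  Submodule.span K {T | ∃ a ∈ U, ∃ b ∈ U, T = wedgePair K a b}

/-- `(αx + a') ∧ (βx + b') = x ∧ (αb' - βa') + a' ∧ b'`. -/
theorem exists_eq_wedgePair_add {x : V} {U : Submodule K V} {T : ⋀[K]^2 V}
    (hT : T ∈ wedgeSquare (Submodule.span K {x} ⊔ U)) :
    ∃ w ∈ U, ∃ T' ∈ wedgeSquare U, T = wedgePair K x w + T' := by
  induction hT using Submodule.span_induction with
  | mem T h =>
    obtain ⟨a, ha, b, hb, rfl⟩ := h
    obtain ⟨_, hα, a', ha', rfl⟩ := Submodule.mem_sup.1 ha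
    obtain ⟨α, rfl⟩ := Submodule.mem_span_singleton.1 hα
    obtain ⟨_, hβ, b', hb', rfl⟩ := Submodule.mem_sup.1 hb
    obtain ⟨β, rfl⟩ := Submodule.mem_span_singleton.1 hβ
    refine ⟨α • b' - β • a', U.sub_mem (U.smul_mem _ hb') (U.smul_mem _ ha'), wedgePair K a' b',
      Submodule.subset_span ⟨a', ha', b', hb', rfl⟩, ?_⟩
    simp only [map_add, map_sub, map_smul, LinearMap.add_apply, LinearMap.smul_apply,
      wedgePair_self, smul_zero, zero_add]
    rw [wedgePair_swap a' x]
    module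
  | zero => exact ⟨0, U.zero_mem, 0, zero_mem _, by simp⟩
  | add S T _ _ hS hT =>
    obtain ⟨w, hw, S', hS', rfl⟩ := hS
    obtain ⟨w', hw', T', hT', rfl⟩ := hT
    exact ⟨w + w', U.add_mem hw hw', S' + T', add_mem hS' hT', by rw [map_add]; abel⟩
  | smul c T _ hT =>
    obtain ⟨w, hw, T', hT', rfl⟩ := hT
    exact ⟨c • w, U.smul_mem c hw, c • T', Submodule.smul_mem _ c hT', by
      rw [map_smul, smul_add]⟩

theorem Submodule.exists_eq_span_singleton_sup [FiniteDimensional K V] {U : Submodule K V} {w : V}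
    (hw : w ∈ U) (hw0 : w ≠ 0) :
    ∃ U' : Submodule K V, U = Submodule.span K {w} ⊔ U' ∧
      Module.finrank K U = Module.finrank K U' + 1 := by
  obtain ⟨C, hC⟩ := Submodule.exists_isCompl (Submodule.span K {w})
  have hle : Submodule.span K {w} ≤ U := by simpa using hw
  have hsup : Submodule.span K {w} ⊔ C ⊓ U = U := by
    rw [← sup_inf_assoc_of_le _ hle, hC.sup_eq_top, top_inf_eq]
  refine ⟨C ⊓ U, hsup.symm, ?_⟩
  have hdisj : Submodule.span K {w} ⊓ (C ⊓ U) = ⊥ := by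
    rw [← inf_assoc, hC.inf_eq_bot, bot_inf_eq]
  have := Submodule.finrank_sup_add_finrank_inf_eq (Submodule.span K {w}) (C ⊓ U)
  rw [hsup, hdisj, finrank_bot, finrank_span_singleton hw0] at this
  omega

/-- Every element of `⋀² U` is a sum of at most `(dim U) / 2` decomposable vectors. -/
theorem isWedgeSum_of_mem_wedgeSquare [FiniteDimensional K V] (n : ℕ) :
    ∀ (U : Submodule K V), Module.finrank K U ≤ n → ∀ T ∈ wedgeSquare U, IsWedgeSum (n / 2) T := by
  induction n using Nat.strong_induction_on with
  | _ n ih =>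
    intro U hU T hT
    have hzero : IsWedgeSum (k := 2) (K := K) (V := V) 0 0 := ⟨0, by simp⟩
    by_cases hbot : U = ⊥
    · have : T = 0 := by
        subst hbot
        refine (Submodule.span_le (p := ⊥)).2 ?_ hT
        rintro _ ⟨a, ha, b, hb, rfl⟩
        simp [(Submodule.mem_bot K).1 ha]
      rw [this]
      exact hzero.mono (by norm_num) (Nat.zero_le _)
    obtain ⟨x, hx, hx0⟩ := Submodule.exists_mem_ne_zero_of_ne_bot hbot
    obtain ⟨U', rfl, hU'⟩ := Submodule.exists_eq_span_singleton_sup hx hx0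
    obtain ⟨w, hw, T', hT', rfl⟩ := exists_eq_wedgePair_add hT
    by_cases hw0 : w = 0
    · have := ih (n - 1) (by omega) U' (by omega) T' hT'
      rw [hw0, map_zero, zero_add]
      exact this.mono (by norm_num) (by omega)
    obtain ⟨U'', rfl, hU''⟩ := Submodule.exists_eq_span_singleton_sup hw hw0
    obtain ⟨w', hw', T'', hT'', rfl⟩ := exists_eq_wedgePair_add hT'
    -- `x ∧ w + w ∧ w' = (x - w') ∧ w`: a single decomposable accounts for two dimensions.
    have := (ih (n - 2) (by omega) U'' (by omega) T'' hT'').add_ιMulti ![x - w', w]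
    rw [show n / 2 = (n - 2) / 2 + 1 by omega]
    convert this using 1
    rw [ιMulti_two]
    simp only [Matrix.cons_val_zero, Matrix.cons_val_one, map_sub, LinearMap.sub_apply]
    rw [wedgePair_swap w' w]
    abel

theorem isWedgeSum_finrank_div_two [FiniteDimensional K V] (T : ⋀[K]^2 V) :
    IsWedgeSum (Module.finrank K V / 2) T := by
  refine isWedgeSum_of_mem_wedgeSquare _ ⊤ (by simp) T ?_
  have : T ∈ Submodule.span K (Set.range (exteriorPower.ιMulti K 2 (M := V))) := by
    rw [exteriorPower.ιMulti_span]
    trivial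
  refine Submodule.span_mono ?_ this
  rintro _ ⟨v, rfl⟩
  exact ⟨v 0, trivial, v 1, trivial, ιMulti_two v⟩

end TwoVectors

/-! ### Secant varieties for `k = 2` -/

section PairMap

variable {I : Type*} {s : ℕ}

/-- The ordered pairs of distinct elements of `Fin s × Fin 2`, starting with the pairs of the same
block. -/
abbrev BlockPair (s : ℕ) : Type := Fin s ⊕ (Σ b : Fin s, Fin b) × Fin 2 × Fin 2

/-- The smaller element of a pair. -/
def BlockPair.fst : BlockPair s → Fin s × Fin 2
  | .inl l => (l, 0)
  | .inr (⟨b, a⟩, i, _) => (⟨a, a.2.trans b.2⟩, i)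

/-- The larger element of a pair. -/
def BlockPair.snd : BlockPair s → Fin s × Fin 2
  | .inl l => (l, 1)
  | .inr (⟨b, _⟩, _, i) => (b, i)

/-- The code `(l, i) ↦ 2l + i` orders the `2s` indices; a `BlockPair` is exactly a strictly
increasing pair for it. -/
theorem BlockPair.lt (p : BlockPair s) :
    2 * (p.fst.1 : ℕ) + p.fst.2 < 2 * (p.snd.1 : ℕ) + p.snd.2 := by
  rcases p with l | ⟨⟨b, a⟩, i, i'⟩
  · simp [fst, snd]
  · simp only [fst, snd]
    omega

theorem BlockPair.ext {p q : BlockPair s} (h₁ : p.fst = q.fst) (h₂ : p.snd = q.snd) : p = q := by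
  rcases p with l | ⟨⟨b, a⟩, i, i'⟩ <;> rcases q with m | ⟨⟨d, c⟩, j, j'⟩
  · simpa [fst] using h₁
  · simp only [fst, snd, Prod.ext_iff, Fin.ext_iff] at h₁ h₂
    omega
  · simp only [fst, snd, Prod.ext_iff, Fin.ext_iff] at h₁ h₂
    omega
  · simp only [fst, snd, Prod.mk.injEq] at h₁ h₂
    obtain ⟨rfl, rfl⟩ := h₂
    obtain ⟨h, rfl⟩ := h₁
    obtain rfl : a = c := Fin.ext (by simpa using h)
    rfl

theorem BlockPair.exists_of_lt {t t' : Fin s × Fin 2}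
    (h : 2 * (t.1 : ℕ) + t.2 < 2 * (t'.1 : ℕ) + t'.2) :
    ∃ p : BlockPair s, p.fst = t ∧ p.snd = t' := by
  obtain ⟨l, i⟩ := t
  obtain ⟨l', i'⟩ := t'
  simp only at h
  by_cases hl : l = l'
  · subst hl
    exact ⟨.inl l, by simp only [fst, Prod.ext_iff, Fin.ext_iff]; simp; omega,
      by simp only [snd, Prod.ext_iff, Fin.ext_iff]; simp; omega⟩
  · exact ⟨.inr (⟨l', ⟨l, by omega⟩⟩, i, i'), rfl, rfl⟩

theorem BlockPair.card : Fintype.card (BlockPair s) = s + 4 * s.choose 2 := by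
  simp only [BlockPair, Fintype.card_sum, Fintype.card_prod, Fintype.card_sigma, Fintype.card_fin]
  rw [Fin.sum_univ_eq_sum_range (fun b => b), Finset.sum_range_id, Nat.choose_two_right]
  ring

/-- The parameters of the exterior `2`-vectors of rank at most `2 s`. -/
abbrev PairParam (σ : Fin s × Fin 2 → I) : Type _ :=
  BlockPair s ⊕ (Fin s × Fin 2) × {j // j ∉ Set.range σ}

theorem PairParam.card [Fintype I] [DecidableEq I] {σ : Fin s × Fin 2 → I}
    (hσ : Function.Injective σ) :
    Fintype.card (PairParam σ) = s + 4 * s.choose 2 + s * 2 * (Fintype.card I - s * 2) := by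
  rw [Fintype.card_sum, BlockPair.card, Fintype.card_prod, card_compl_range hσ]
  simp

/-- The pairs of basis indices of the tangent vectors at a sum of wedges of disjoint pairs. -/
def pairIndex [DecidableEq I] (σ : Fin s × Fin 2 → I) : PairParam σ → Fin 2 → I
  | .inl p => ![σ p.fst, σ p.snd]
  | .inr (t, j) => Function.update (fun i => σ (t.1, i)) t.2 j

theorem mem_range_pairIndex_inr [DecidableEq I] (σ : Fin s × Fin 2 → I) (t : Fin s × Fin 2)
    (j : {j // j ∉ Set.range σ}) (x : I) :
    x ∈ Set.range (pairIndex σ (.inr (t, j))) ↔ x = j ∨ x = σ (t.1, t.2.rev) := by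
  constructor
  · rintro ⟨i, rfl⟩
    by_cases h : i = t.2
    · subst h
      simp [pairIndex]
    · right
      have : i = t.2.rev := by
        generalize t.2 = m at h
        fin_cases i <;> fin_cases m <;> simp_all
      simp [pairIndex, h, ← this]
  · rintro (rfl | rfl)
    · exact ⟨t.2, by simp [pairIndex]⟩
    · have : t.2.rev ≠ t.2 := by
        generalize t.2 = m
        fin_cases m <;> simp
      exact ⟨t.2.rev, by simp [pairIndex, this]⟩

theorem pairIndex_injective [DecidableEq I] {σ : Fin s × Fin 2 → I} (hσ : Function.Injective σ)
    (a : PairParam σ) : Function.Injective (pairIndex σ a) := by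
  have h01 : ∀ f : Fin 2 → I, f 0 ≠ f 1 → Function.Injective f := by
    intro f hf i j hij
    fin_cases i <;> fin_cases j <;> simp_all
  apply h01
  rcases a with p | ⟨⟨l, i⟩, j, hj⟩
  · intro h
    have := p.lt
    rw [show p.fst = p.snd from hσ h] at this
    exact lt_irrefl _ this
  · have hj' : ∀ x, σ x ≠ j := fun x hx => hj ⟨x, hx⟩
    fin_cases i
    · simpa [pairIndex] using (hj' _).symm
    · simpa [pairIndex] using hj' _

/-- Replacement indices `j` lie outside all blocks, not just one, so each pair occurs once:
increasing pairs are determined by their set, and a mixed pair by `j` and the surviving partner. -/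
theorem eq_of_range_pairIndex_subset [DecidableEq I] {σ : Fin s × Fin 2 → I}
    (hσ : Function.Injective σ) (a b : PairParam σ)
    (h : Set.range (pairIndex σ a) ⊆ Set.range (pairIndex σ b)) : a = b := by
  have hinl : ∀ (p : BlockPair s) x, x ∈ Set.range (pairIndex σ (.inl p)) ↔
      x = σ p.fst ∨ x = σ p.snd := by
    intro p x
    simp only [pairIndex, Set.mem_range, Fin.exists_fin_two, Matrix.cons_val_zero,
      Matrix.cons_val_one, eq_comm]
  rcases a with p | ⟨t, j⟩ <;> rcases b with q | ⟨t', j'⟩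
  · have h1 := (hinl q _).1 (h ((hinl p _).2 (Or.inl rfl)))
    have h2 := (hinl q _).1 (h ((hinl p _).2 (Or.inr rfl)))
    simp only [hσ.eq_iff] at h1 h2
    have hp := p.lt
    have hq := q.lt
    rcases h1 with h1 | h1 <;> rcases h2 with h2 | h2
    · rw [h1, h2] at hp
      exact absurd hp (lt_irrefl _)
    · rw [BlockPair.ext h1 h2]
    · rw [h1, h2] at hp
      exact absurd hp hq.asymm
    · rw [h1, h2] at hp
      exact absurd hp (lt_irrefl _)
  · have hj : ∀ x, σ x ≠ j' := fun x hx => j'.2 ⟨x, hx⟩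
    have h1 := (mem_range_pairIndex_inr σ _ _ _).1 (h ((hinl p _).2 (Or.inl rfl)))
    have h2 := (mem_range_pairIndex_inr σ _ _ _).1 (h ((hinl p _).2 (Or.inr rfl)))
    have := p.lt
    rw [hσ (h1.resolve_left (hj _)), hσ (h2.resolve_left (hj _))] at this
    exact absurd this (lt_irrefl _)
  · have h1 := (hinl q _).1 (h ((mem_range_pairIndex_inr σ t j _).2 (Or.inl rfl)))
    exact absurd (h1.elim (fun h => ⟨_, h.symm⟩) fun h => ⟨_, h.symm⟩) j.2
  · have h1 := (mem_range_pairIndex_inr σ _ _ _).1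
      (h ((mem_range_pairIndex_inr σ t j _).2 (Or.inl rfl)))
    have h2 := (mem_range_pairIndex_inr σ _ _ _).1
      (h ((mem_range_pairIndex_inr σ t j _).2 (Or.inr rfl)))
    obtain rfl : j = j' := Subtype.ext (h1.resolve_right fun h => j.2 ⟨_, h.symm⟩)
    have h3 := hσ (h2.resolve_left fun h => j.2 ⟨_, h⟩)
    simp only [Prod.mk.injEq, Fin.rev_inj] at h3
    obtain rfl : t = t' := Prod.ext h3.1 h3.2
    rfl

/-! ### Parametrization of bivectors by `2s` chart vectors -/

variable {K V : Type*} [Field K] [AddCommGroup V] [Module K V] [Fintype I]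
  (e : Module.Basis I K V) (σ : Fin s × Fin 2 → I) [DecidablePred (· ∈ Set.range σ)]

/-- The vectors of the chart determined by the parameters. -/
noncomputable def pairVec (x : PairParam σ → K) : Fin s × Fin 2 → V :=
  chartVec e σ fun i j => x (.inr (i, j))

/-- A parametrization of the generic exterior `2`-vectors of rank at most `2 s`. -/
noncomputable def pairMap (x : PairParam σ → K) : ⋀[K]^2 V :=
  ∑ p : BlockPair s, x (.inl p) • wedgePair K (pairVec e σ x p.fst) (pairVec e σ x p.snd)

theorem isPolyMap_pairMap [FiniteDimensional K V] : IsPolyMap (pairMap e σ) := by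
  have hv : ∀ t, IsPolyMap fun x => pairVec e σ x t := fun t =>
    IsPolyMap.chartVec e _ (fun i j => IsPolyMap.coord _) t
  refine IsPolyMap.sum _ fun p _ => (IsPolyMap.coord _).smul ?_
  have : (fun x => wedgePair K (pairVec e σ x p.fst) (pairVec e σ x p.snd)) = fun x =>
      exteriorPower.ιMulti K 2 fun i => (![pairVec e σ x p.fst, pairVec e σ x p.snd] : Fin 2 → V) i := by
    funext x
    rw [ιMulti_two]
    rfl
  rw [this]
  refine IsPolyMap.ιMulti fun i => ?_
  fin_cases i
  · exact hv _
  · exact hv _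

/-- The value lies in `⋀²` of a space spanned by `2s` vectors, so the normal form applies. -/
theorem isWedgeSum_pairMap [FiniteDimensional K V] (x : PairParam σ → K) :
    IsWedgeSum s (pairMap e σ x) := by
  have hfin : Module.finrank K (Submodule.span K (Set.range (pairVec e σ x))) ≤ s * 2 := by
    refine (finrank_range_le_card _).trans ?_
    simp
  have := isWedgeSum_of_mem_wedgeSquare _ _ hfin (pairMap e σ x) ?_
  · simpa using this
  · exact Submodule.sum_mem _ fun p _ => Submodule.smul_mem _ _ (Submodule.subset_span
      ⟨_, Submodule.subset_span ⟨_, rfl⟩, _, Submodule.subset_span ⟨_, rfl⟩, rfl⟩)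

/-- The image of the parametrization is Zariski dense in the sums of `s` decomposable vectors. -/
theorem polyEval_eq_zero_of_isWedgeSum [Infinite K] [FiniteDimensional K V]
    (hσ : Function.Injective σ) (p : MvPolynomial (Module.Dual K (⋀[K]^2 V)) K)
    (hp : VanishesOn p (Set.range (pairMap e σ))) (T : ⋀[K]^2 V) (hT : IsWedgeSum s T) :
    polyEval p T = 0 := by
  obtain ⟨v, rfl⟩ := hT
  refine polyEval_sum_ιMulti_eq_zero p
    (fun v => (coordBlock e σ fun t => v t.1 t.2).det ≠ 0) (fun l i => e (σ (l, i)))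
    (fun v => ?_) (fun v hv => ?_) v
  · refine (finite_setOf_det_coordBlock_eq_zero e hσ fun t => v t.1 t.2).subset fun t ht => ?_
    exact not_not.1 ht
  obtain ⟨b, hb⟩ := exists_eq_sum_chartVec e hσ _ hv
  have hmem : ∑ l, exteriorPower.ιMulti K 2 (v l) ∈ Submodule.span K
      (Set.range fun q : BlockPair s => wedgePair K (chartVec e σ b q.fst)
        (chartVec e σ b q.snd)) := by
    refine Submodule.sum_mem _ fun l _ => ?_
    rw [ιMulti_two, hb (l, 0), hb (l, 1)]
    simp only [map_sum, map_smul, LinearMap.sum_apply, LinearMap.smul_apply]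
    refine Submodule.sum_mem _ fun t _ => Submodule.smul_mem _ _ <|
      Submodule.sum_mem _ fun t' _ => Submodule.smul_mem _ _ ?_
    rcases lt_trichotomy (2 * (t.1 : ℕ) + t.2) (2 * (t'.1 : ℕ) + t'.2) with h | h | h
    · obtain ⟨q, rfl, rfl⟩ := BlockPair.exists_of_lt h
      rw [wedgePair_swap]
      exact neg_mem (Submodule.subset_span ⟨q, rfl⟩)
    · have : t = t' := by
        simp only [Prod.ext_iff, Fin.ext_iff]
        omega
      rw [this, wedgePair_self]
      exact zero_mem _
    · obtain ⟨q, rfl, rfl⟩ := BlockPair.exists_of_lt h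
      exact Submodule.subset_span ⟨q, rfl⟩
  obtain ⟨c, hc⟩ := (Submodule.mem_span_range_iff_exists_fun K).1 hmem
  rw [← hc]
  exact hp _ ⟨Sum.elim c fun a => b a.1 a.2, rfl⟩

theorem projDim_secantVariety_two [CharZero K] [FiniteDimensional K V] [DecidableEq I]
    (e : Module.Basis I K V) {σ : Fin s × Fin 2 → I} {D : ℕ} (hs : 1 ≤ s) (hσ : Function.Injective σ)
    (hD : s + 4 * s.choose 2 + s * 2 * (Fintype.card I - s * 2) = D + 1) :
    projDim (secantVariety (pluckerGrassmannian K V 2) s) = D := by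
  classical
  obtain ⟨ℓ, hℓ⟩ := exists_dual_ιMulti_basis e (pairIndex σ) (pairIndex_injective hσ)
    (eq_of_range_pairIndex_subset hσ)
  let w : PairParam σ → ⋀[K]^2 V := fun a => exteriorPower.ιMulti K 2 fun i => e (pairIndex σ a i)
  -- Coefficient `1` on same-block pairs and `0` on cross pairs: the base point is `∑ e_{l,0} ∧
  -- e_{l,1}`.
  let y : PairParam σ → K := Sum.elim (Sum.elim 1 0) 0
  have hw0 : ∀ p, w (.inl p) = wedgePair K (e (σ p.fst)) (e (σ p.snd)) := fun p => ιMulti_two _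
  have hφy : pairMap e σ y = ∑ l, w (.inl (.inl l)) := by
    have hu : ∀ t, pairVec e σ y t = e (σ t) := fun t => chartVec_zero e _ (fun i j => rfl) t
    simp only [pairMap, hu, Fintype.sum_sum_type, y, hw0]
    simp
  have hw : ∀ a t, pairMap e σ (y + Pi.single a t) = pairMap e σ y + t • w a := by
    rintro (p | ⟨⟨l, i⟩, j⟩) t
    · have hu : ∀ t', pairVec e σ (y + Pi.single (.inl p) t) t' = e (σ t') := fun t' =>
        chartVec_zero e _ (fun i j => by simp [y]) t'
      have hu' : ∀ t, pairVec e σ y t = e (σ t) := fun t => chartVec_zero e _ (fun i j => rfl) t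
      simp only [pairMap, hu, hu', hw0, Pi.add_apply, add_smul, Finset.sum_add_distrib]
      congr 1
      rw [Finset.sum_eq_single_of_mem p (Finset.mem_univ p)]
      · simp
      · intro q _ hq
        rw [Pi.single_eq_of_ne (by simpa using hq), zero_smul]
    · have hu : ∀ t', pairVec e σ (y + Pi.single (.inr ((l, i), j)) t) t' =
          e (σ t') + if t' = (l, i) then t • e j else 0 := fun t' =>
        chartVec_single e (l, i) j t _ (fun i' j' => by simp [y, Pi.single_apply]) t'
      have hy : ∀ p : BlockPair s, (y + Pi.single (.inr ((l, i), j)) t : PairParam σ → K) (.inl p) =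
          y (.inl p) := fun p => by simp
      rw [hφy]
      simp only [pairMap, hu, hy]
      -- Cross pairs have coefficient `0` here, so moving one vector affects only the wedge of its
      -- own block.
      rw [Fintype.sum_sum_type]
      simp only [y, Sum.elim_inl, Sum.elim_inr, Pi.zero_apply, Pi.one_apply, zero_smul, one_smul,
        Finset.sum_const_zero, add_zero]
      rw [← Finset.add_sum_erase _ _ (Finset.mem_univ l), ← Finset.add_sum_erase _
        (fun l => w (.inl (.inl l))) (Finset.mem_univ l), add_right_comm]
      have hl : ∀ l', wedgePair K
          (e (σ (BlockPair.fst (.inl l'))) +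
            if BlockPair.fst (.inl l') = (l, i) then t • e j else 0)
          (e (σ (BlockPair.snd (.inl l'))) +
            if BlockPair.snd (.inl l') = (l, i) then t • e j else 0) =
          exteriorPower.ιMulti K 2 fun i' =>
            e (σ (l', i')) + if (l', i') = (l, i) then t • e j else 0 := fun l' => by
        rw [ιMulti_two]
        rfl
      have hl0 : ∀ l', w (.inl (.inl l')) = exteriorPower.ιMulti K 2 fun i' => e (σ (l', i')) :=
        fun l' => by
          rw [hw0, ιMulti_two]
          rfl
      congr 1
      · rw [hl, hl0]
        simp only [Prod.mk.injEq, true_and]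
        rw [ιMulti_add_ite]
        simp only [w, pairIndex]
        congr 3
        funext i'
        by_cases h : i' = i
        · subst h
          simp
        · simp [h]
      · refine Finset.sum_congr rfl fun l' hl' => ?_
        rw [hl, hl0]
        simp [Finset.ne_of_mem_erase hl']
  refine projDim_closure_eq (S := secantUnion (pluckerGrassmannian K V 2) s)
    (isPolyMap_pairMap e σ) ?_ ?_ y w hw ℓ hℓ (.inl (.inl ⟨0, hs⟩)) ?_
    ((PairParam.card hσ).trans hD)
  · rintro _ ⟨x, hx, rfl⟩
    exact subset_closure (mk_mem_secantUnion hx (isWedgeSum_pairMap e σ x))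
  · exact fun p hp T hT => polyEval_eq_zero_of_isWedgeSum e σ hσ p hp T
      (isWedgeSum_of_mem_affineCone_secantUnion (by norm_num) hT)
  · rw [hφy, map_sum]
    simp only [w, hℓ]
    rw [Finset.sum_eq_single_of_mem ⟨0, hs⟩ (Finset.mem_univ _)]
    · simp
    · intro l _ hl
      rw [if_neg]
      simpa using hl.symm

end PairMap

/-! ### The typical rank -/

section TypicalRank

variable {K V : Type*} [Field K] [AddCommGroup V] [Module K V]

theorem isClosed_affineZariski_setOf_polyEval_eq_zero {W : Type*} [AddCommGroup W] [Module K W]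
    (p : MvPolynomial (Module.Dual K W) K) :
    @IsClosed W (affineZariski K W) {w | polyEval p w = 0} := by
  rw [← @isOpen_compl_iff]
  change _ᶜᶜ ∈ {Z : Set W | ∃ S : Set (W → K), S ⊆ _ ∧ Z = {x | ∀ f ∈ S, f x = 0}}
  rw [compl_compl]
  exact ⟨{polyEval p}, by rintro _ rfl; exact ⟨p, rfl⟩, by ext; simp⟩

/-- A polynomial map with fewer parameters than the dimension of the target is not dominant. -/
theorem IsPolyMap.exists_vanishesOn_range [CharZero K] {W ι : Type*} [AddCommGroup W] [Module K W]
    [FiniteDimensional K W] [Fintype ι] {φ : (ι → K) → W} (hφ : IsPolyMap φ)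
    (hcard : Fintype.card ι < Module.finrank K W) :
    ∃ p : MvPolynomial (Module.Dual K W) K, VanishesOn p (Set.range φ) ∧
      ¬ VanishesOn p Set.univ := by
  -- Otherwise the coordinate forms, independent on `W`, would be independent on the range,
  -- exceeding the number of parameters.
  by_contra! hcon
  let b := Module.finBasis K W
  have hlin : IsPolyMap fun x : Fin (Module.finrank K W) → K => ∑ i, x i • b i :=
    IsPolyMap.sum _ fun i _ => (IsPolyMap.coord i).smul (IsPolyMap.const _)
  have hind := hlin.indepOn_range 0 b (fun j t => by
    simp only [zero_add, Pi.zero_apply, zero_smul, Finset.sum_const_zero]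
    rw [Finset.sum_eq_single_of_mem j (Finset.mem_univ j) fun i _ hi => by
      rw [Pi.single_eq_of_ne hi, zero_smul], Pi.single_eq_same]) b.coord
    (fun i j => by simp [Finsupp.single_apply, eq_comm])
  have := hind.le_card hφ fun p hp => (hcon p hp).mono (Set.subset_univ _)
  omega

theorem exists_injective_fin_prod {s k m : ℕ} (h : s * k ≤ m) :
    ∃ σ : Fin s × Fin k → Fin m, Function.Injective σ :=
  ⟨Fin.castLE h ∘ finProdFinEquiv,
    (Fin.castLE_injective h).comp finProdFinEquiv.injective⟩

/-- Pairs from `2s + q` indices lie inside the first `2s`, are mixed, or lie inside the last `q`.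
The last kind counts the codimension of the parametrized cone. -/
theorem add_four_choose_two_add (s q : ℕ) :
    s + 4 * s.choose 2 + s * 2 * q + q.choose 2 = (2 * s + q).choose 2 := by
  qify
  simp only [Nat.cast_choose_two]
  push_cast
  ring

/-- Below half the dimension at least two basis indices remain unused, so the parametrization misses
at least one dimension and all vectors of that rank lie in a proper closed set. -/
theorem typicalRank_two [CharZero K] [FiniteDimensional K V] :
    typicalRank K V 2 = (Module.finrank K V / 2 : ℕ) := by
  classical
  apply le_antisymm
  · exact sInf_le ⟨Set.univ, @dense_univ _ (affineZariski K _), fun T _ =>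
      (wedgeRank_le_iff (by norm_num)).2 (isWedgeSum_finrank_div_two T)⟩
  refine le_sInf fun r ⟨U, hU, hr⟩ => ?_
  by_contra! hlt
  obtain ⟨r, rfl⟩ := ENat.ne_top_iff_exists.1 hlt.ne_top
  rw [Nat.cast_lt] at hlt
  obtain ⟨σ, hσ⟩ := exists_injective_fin_prod (s := r) (k := 2) (m := Module.finrank K V) (by omega)
  let e := Module.finBasis K V
  obtain ⟨p, hp, hpu⟩ := (isPolyMap_pairMap e σ).exists_vanishesOn_range (by
    rw [PairParam.card hσ, exteriorPower.finrank_eq, Fintype.card_fin]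
    have := add_four_choose_two_add r (Module.finrank K V - r * 2)
    rw [show 2 * r + (Module.finrank K V - r * 2) = Module.finrank K V by omega] at this
    have := Nat.choose_pos (show 2 ≤ Module.finrank K V - r * 2 by omega)
    omega)
  apply hpu
  have hsub : U ⊆ {T | polyEval p T = 0} := fun T hT =>
    polyEval_eq_zero_of_isWedgeSum e σ hσ p hp T ((wedgeRank_le_iff (by norm_num)).1 (hr T hT))
  intro T _
  have hcl := @closure_minimal _ (affineZariski K _) _ _ hsub
    (isClosed_affineZariski_setOf_polyEval_eq_zero p)
  exact hcl (hU T)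

end TypicalRank

/-! ### The main theorem -/

theorem theorem2p1 {K V : Type*} [Field K] [IsAlgClosed K] [CharZero K]
    [AddCommGroup V] [Module K V] (n : ℕ) (hV : Module.finrank K V = n + 1) :
    (typicalRank K V 2 = ((n + 1) / 2 : ℕ) ∧
      ∀ s : ℕ, 1 ≤ s → (s : ℕ∞) < typicalRank K V 2 →
        ∃ D : ℕ, projDim (secantVariety (pluckerGrassmannian K V 2) s) = D ∧
          D + 2 * s * (s - 1) = s * (2 * (n + 1 - 2)) + s - 1 ∧
          D + min (2 * s * (s - 1)) ((n + 1 - 2 * s).choose 2) =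
            expectedSecantDim ((n + 1).choose 2 - 1) (2 * (n + 1 - 2)) s ∧
          (2 ≤ s → D < expectedSecantDim ((n + 1).choose 2 - 1) (2 * (n + 1 - 2)) s)) ∧
    (∀ k s : ℕ, 3 ≤ k → 1 ≤ s → k * s ≤ n + 1 →
      projDim (secantVariety (pluckerGrassmannian K V k) s) =
        (expectedSecantDim ((n + 1).choose k - 1) (k * (n + 1 - k)) s : ℕ)) := by
  have : FiniteDimensional K V := Module.finite_of_finrank_pos (by omega)
  let e : Module.Basis (Fin (n + 1)) K V := Module.finBasisOfFinrankEq K V hV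
  have hrank := typicalRank_two (K := K) (V := V)
  rw [hV] at hrank
  refine ⟨⟨hrank, fun s hs hlt => ?_⟩, fun k s hk hs hle => ?_⟩
  · rw [hrank, Nat.cast_lt] at hlt
    obtain ⟨σ, hσ⟩ := exists_injective_fin_prod (s := s) (k := 2) (m := n + 1) (by omega)
    obtain ⟨D, hD⟩ : ∃ D, s + 4 * s.choose 2 + s * 2 * (n + 1 - s * 2) = D + 1 :=
      ⟨_, (Nat.succ_pred_eq_of_pos (by omega)).symm⟩
    have hdim := projDim_secantVariety_two e hs hσ (by rw [Fintype.card_fin]; exact hD)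
    obtain ⟨q, hq⟩ : ∃ q, n + 1 = 2 * s + q := ⟨n + 1 - 2 * s, by omega⟩
    have hq2 : 2 ≤ q := by omega
    have hchoose := add_four_choose_two_add s q
    have hqpos := Nat.choose_pos hq2
    rw [hq, show 2 * s + q - s * 2 = q by omega] at hD
    have h1 : D + 2 * s * (s - 1) = s * (2 * (n + 1 - 2)) + s - 1 := by
      rw [hq, show 2 * s + q - 2 = 2 * (s - 1) + q by omega]
      obtain ⟨t, rfl⟩ : ∃ t, s = t + 1 := ⟨s - 1, by omega⟩
      simp only [Nat.add_sub_cancel]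
      have h2 : 4 * (t + 1).choose 2 = 2 * (t + 1) * t := by
        qify
        rw [Nat.cast_choose_two]
        push_cast
        ring
      rw [h2] at hD
      zify at hD ⊢
      rw [Nat.cast_sub (by omega)]
      push_cast
      linarith
    have h2 : D + (n + 1 - 2 * s).choose 2 = (n + 1).choose 2 - 1 := by
      rw [hq, Nat.add_sub_cancel_left]
      omega
    have h3 : D + min (2 * s * (s - 1)) ((n + 1 - 2 * s).choose 2) =
        expectedSecantDim ((n + 1).choose 2 - 1) (2 * (n + 1 - 2)) s := by
      -- Both entries of the minimum are `D` plus a shortfall, so the defect is the smaller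
      -- shortfall.
      rw [expectedSecantDim, ← h1, ← h2, min_add_add_left, min_comm]
    refine ⟨D, hdim, h1, h3, fun hs2 => ?_⟩
    rw [← h3]
    have hpos : 0 < 2 * s * (s - 1) := Nat.mul_pos (by omega) (by omega)
    have : 0 < (n + 1 - 2 * s).choose 2 := Nat.choose_pos (by omega)
    exact Nat.lt_add_of_pos_right (lt_min hpos this)
  · obtain ⟨σ, hσ⟩ := exists_injective_fin_prod (s := s) (k := k) (m := n + 1)
      (by rw [mul_comm]; exact hle)
    obtain ⟨D, hD⟩ : ∃ D, s * (k * (n + 1 - k) + 1) = D + 1 :=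
      ⟨_, (Nat.succ_pred_eq_of_pos (Nat.mul_pos (by omega) (by omega))).symm⟩
    obtain ⟨hdim, hfin⟩ := projDim_secantVariety_of_three_le e hk hs hσ
      (by rw [Fintype.card_fin]; exact hD)
    rw [exteriorPower.finrank_eq, hV] at hfin
    rw [hdim, expectedSecantDim]
    rw [mul_add, mul_one] at hD
    -- The parameter count never exceeds the ambient dimension, by `hfin`.
    rw [min_eq_right (by omega)]
    congr 2
    omega
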